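/- **Setting.** Let $\mathcal G$ be a finite undirected graph on $N$ nodes in which every node has a neighbour; write $\mathcal N_i$ for the neighbours of $i$ and $\tilde{\mathcal N}_i=\mathcal N_i\cup\{i\}$. Node $i$ chooses allocations $x_i\in\mathbb R^{\tilde{\mathcal N}_i}$ (with $x_i(j)=0$ for $j\notin\tilde{\mathcal N}_i$) and has a closed convex action set $\mathcal X_i\subseteq\mathbb R_+^{\tilde{\mathcal N}_i}$ which lies in a ball of radius $R_i$ and contains a ball of radius $r_i>0$. In round $t$ node $i$ has demand $l_{i,t}\ge 1/L$ (with $L>0$ fixed) and random generation $d_{i,t}\ge 0$. For a joint allocation $x=(x_k)_k$ put $$f_{i,t}(x)=1-\frac1{|\tilde{\mathcal N}_i|}\sum_{j\in\tilde{\mathcal N}_i}\min\Big\{\frac{\sum_{k\in\tilde{\mathcal N}_j}x_k(j)}{l_{j,t}},1\Big\},\qquad g_{i,t}(x_i)=\sum_{j\in\tilde{\mathcal N}_i}x_i(j)-d_{i,t},$$ and assume $|f_{i,t}|\le F_i$ on $\prod_k\mathcal X_k$ and $|g_{i,t}|\le G_i$ on $\mathcal X_i$, with $F_i,G_i>0$.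 **Parameters** (path length $P_T=0$). $\tilde L_i=3L+LR_i/r_i$, $\delta_{i,t}=\big(\tfrac{|\mathcal N_i|F_i}{\tilde L_i}\big)^{1/2}\big(\tfrac{R_i^2/2}{t}\big)^{1/4}$, $\xi_{i,t}=\delta_{i,t}/r_i$, $\beta_{i,t}=\tfrac1{G_it^{1/2}}$, $\gamma_{i,t}=\tfrac1{G_i^2t^{1/2}}$, $K=\lceil\tfrac12\log_2(1+T)\rceil+1$ experts with step sizes $\eta^k_{i,t}=2^{k-1}\sqrt{\tfrac{2R_i^3}{2|\mathcal N_i|F_i\tilde L_i}}\;t^{-3/4}$, $k=1,\dots,K$, and a learning rate $\epsilon>0$. **Algorithm (MA-NSDRS).** Initially $z^k_{i,1}=z_i\in(1-\xi_{i,1})\mathcal X_i$ for all $k$, $\omega^k_{i,1}=\tfrac{K+1}{K}\tfrac1{k(k+1)}$, $q_{i,1}=0$. In round $t=1,\dots,T$ every node $i$ forms $z_{i,t}=\sum_k\omega^k_{i,t}z^k_{i,t}$ and $x_{i,t}=z_{i,t}+\delta_{i,t}u_{i,t}$ with $u_{i,t}$ uniform on the unit sphere of $\mathbb R^{\tilde{\mathcal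 N}_i}$, and plays $x'_{i,t}=\frac{d_{i,t}}{\sum_jx_{i,t}(j)}x_{i,t}$ if $\sum_jx_{i,t}(j)>d_{i,t}$, and $x'_{i,t}=x_{i,t}$ otherwise. Write $f_{i,t}(y)$ for the loss of $i$ when $i$ uses $y$ and every other node $k$ uses $x'_{k,t}$. With $$\hat\nabla f_{i,t}=\tfrac{N}{\delta_{i,t}}f_{i,t}(x_{i,t})u_{i,t},\qquad \hat\nabla g_{i,t}=\tfrac N{\delta_{i,t}}g_{i,t}(x_{i,t})u_{i,t},$$ the updates are $$q_{i,t+1}=\big(q_{i,t}+\gamma_{i,t+1}(g_{i,t}(x'_{i,t})-\beta_{i,t+1}q_{i,t})\big)_+,$$ $$z^k_{i,t+1}=\mathcal P_{(1-\xi_{i,t+1})\mathcal X_i}\big(z^k_{i,t}-\eta^k_{i,t+1}(\hat\nabla f_{i,t}+q_{i,t+1}\hat\nabla g_{i,t})\big),$$ $$\omega^k_{i,t+1}\propto\omega^k_{i,t}\exp(-\epsilon\langle\hat\nabla f_{i,t},z^k_{i,t}-z_{i,t}\rangle),\qquad \sum_k\omega^k_{i,t+1}=1,$$ where $\mathcal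 P$ denotes Euclidean projection. All $u_{i,t}$ are independent of each other, and jointly independent of the generations $d$ and the (possibly random) initial points. **Claim.** For a proper choice of the learning rate $\epsilon=\epsilon_T>0$, the static regret is $\tilde{\mathcal O}(T^{3/4})$: there are $\epsilon_T>0$ and constants $C,p$, depending only on the graph, the sets $\mathcal X_i$ and $R_i,r_i,F_i,G_i,L$, such that for all demands, all distributions of the generations and of the initial points as above, all $T\ge1$ and all nodes $i$, $$\mathbb E\Big[\sum_{t=1}^Tf_{i,t}(x_{i,t})\Big]-\mathbb E\Big[\min_{x\in\mathcal X_i}\sum_{t=1}^Tf_{i,t}(x)\Big]\le C\,T^{3/4}(1+\log T)^p ,$$ both random variables being integrable. -/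

import Mathlib

open MeasureTheory ProbabilityTheory
open scoped Pointwise

namespace EnergySharing

section Network

variable {V : Type*} [Fintype V] [DecidableEq V] (G : SimpleGraph V) [DecidableRel G.Adj]

/-- The neighbourhood of node `i` including `i` itself. -/
def closedNbhd (i : V) : Finset V := insert i (G.neighborFinset i)

/-- Allocation vectors of node `i`: one real coordinate for each node of the closed
neighbourhood of `i`, with the Euclidean norm. -/
abbrev Action (i : V) : Type _ := EuclideanSpace ℝ (closedNbhd G i)

variable {G}

/-- The amount sent to node `j` by a node that uses the allocation `y`
(zero when `j` is not in its closed neighbourhood). -/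
def amount {k : V} (y : Action G k) (j : V) : ℝ :=
  if h : j ∈ closedNbhd G k then y ⟨j, h⟩ else 0

/-- Satisfaction level of node `j` under demands `l` and joint allocation `x`. -/
noncomputable def satisfaction (l : V → ℝ) (x : ∀ k, Action G k) (j : V) : ℝ :=
  min ((∑ k ∈ closedNbhd G j, amount (x k) j) / l j) 1

/-- Loss of node `i` under demands `l` and joint allocation `x`. -/
noncomputable def loss (l : V → ℝ) (x : ∀ k, Action G k) (i : V) : ℝ :=
  1 - (1 / ((closedNbhd G i).card : ℝ)) * ∑ j ∈ closedNbhd G i, satisfaction l x j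

/-- Constraint function of node `i` with generation `d`: distributed energy minus generation. -/
noncomputable def constr {i : V} (d : ℝ) (y : Action G i) : ℝ :=
  ∑ j ∈ closedNbhd G i, amount y j - d

/-- Adjustment step: if more than the generation `d` is distributed, rescale the allocation so
that exactly `d` is distributed. -/
noncomputable def adjust {i : V} (d : ℝ) (y : Action G i) : Action G i :=
  if d < ∑ j ∈ closedNbhd G i, amount y j then
    (d / ∑ j ∈ closedNbhd G i, amount y j) • y
  else y

variable (G)

/-- The static data: action sets `X i`, outer and inner radii `R i`, `r i`, bounds `F i` on the
loss and `B i` on the constraint function, and the Lipschitz constant `L` of the losses. -/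
structure Params where
  X : ∀ i, Set (Action G i)
  R : V → ℝ
  r : V → ℝ
  F : V → ℝ
  B : V → ℝ
  L : ℝ

variable {G}

/-- The standing assumptions on the static data. -/
structure Params.Valid (P : Params G) : Prop where
  degree_pos : ∀ i, 0 < G.degree i
  convex : ∀ i, Convex ℝ (P.X i)
  closed : ∀ i, IsClosed (P.X i)
  nonneg : ∀ i, ∀ y ∈ P.X i, ∀ j, 0 ≤ y j
  outer : ∀ i, ∃ c, P.X i ⊆ Metric.closedBall c (P.R i)
  inner : ∀ i, ∃ c, Metric.closedBall c (P.r i) ⊆ P.X i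
  r_pos : ∀ i, 0 < P.r i
  F_pos : ∀ i, 0 < P.F i
  B_pos : ∀ i, 0 < P.B i
  L_pos : 0 < P.L

namespace Params

variable (P : Params G)

/-- `L̃ = 3 L + L R / r`. -/
noncomputable def Ltilde (i : V) : ℝ := 3 * P.L + P.L * P.R i / P.r i

/-- Exploration radius, for path length zero. -/
noncomputable def delta (i : V) (t : ℕ) : ℝ :=
  ((G.degree i : ℝ) * P.F i / P.Ltilde i) ^ (1 / 2 : ℝ) * (P.R i ^ 2 / 2 / (t : ℝ)) ^ (1 / 4 : ℝ)

/-- Shrinkage parameter. -/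
noncomputable def xi (i : V) (t : ℕ) : ℝ := P.delta i t / P.r i

noncomputable def beta (i : V) (t : ℕ) : ℝ := 1 / (P.B i * (t : ℝ) ^ (1 / 2 : ℝ))

noncomputable def gamma (i : V) (t : ℕ) : ℝ := 1 / (P.B i ^ 2 * (t : ℝ) ^ (1 / 2 : ℝ))

/-- Candidate step sizes; the expert with number `k + 1` uses the factor `2 ^ k`. -/
noncomputable def eta (i : V) (k t : ℕ) : ℝ :=
  2 ^ k * Real.sqrt (2 * P.R i ^ 3 / (2 * (G.degree i : ℝ) * P.F i * P.Ltilde i))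
    * (t : ℝ) ^ (-(3 / 4) : ℝ)

end Params

/-- The number of experts for horizon `T`. -/
noncomputable def numExperts (T : ℕ) : ℕ := ⌈Real.logb 2 (1 + (T : ℝ)) / 2⌉₊ + 1

/-- Euclidean projection onto `C`: a point of `C` nearest to `x` (unique when `C` is a nonempty
closed convex set). -/
noncomputable def proj {E : Type*} [MetricSpace E] [Nonempty E] (C : Set E) (x : E) : E :=
  Classical.epsilon fun p => p ∈ C ∧ ∀ y ∈ C, dist x p ≤ dist x y

variable (G) in
/-- The state of all nodes at the beginning of a round: the expert points, the expert weights,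
and the dual variable. -/
structure State (K : ℕ) where
  point : ∀ i, Fin K → Action G i
  weight : V → Fin K → ℝ
  dual : V → ℝ

/-- State at the beginning of round `1`. -/
noncomputable def State.init (K : ℕ) (z₀ : ∀ i, Action G i) : State G K where
  point i _ := z₀ i
  weight _ k := ((K : ℝ) + 1) / K * (1 / (((k : ℝ) + 1) * ((k : ℝ) + 2)))
  dual _ := 0

namespace State

variable {K : ℕ} (s : State G K) (P : Params G) (ε : ℝ) (t : ℕ)
  (l d : V → ℝ) (u : ∀ i, Action G i)

/-- The weighted combination `z` of the expert points. -/
noncomputable def center (i : V) : Action G i := ∑ k, s.weight i k • s.point i k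

/-- The perturbed point `x = z + δ u` of round `t`. -/
noncomputable def query (i : V) : Action G i := s.center i + P.delta i t • u i

/-- The action `x'` that is played in round `t`. -/
noncomputable def played (i : V) : Action G i := adjust (d i) (s.query P t u i)

/-- The loss function of node `i` in round `t`, as a function of its own allocation, the other
nodes transferring what they play. -/
noncomputable def ownLoss (i : V) (y : Action G i) : ℝ :=
  loss l (Function.update (s.played P t d u) i y) i

/-- One-point estimate of the gradient of the loss function. -/
noncomputable def gradLoss (i : V) : Action G i :=
  ((Fintype.card V : ℝ) / P.delta i t * s.ownLoss P t l d u i (s.query P t u i)) • u i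

/-- One-point estimate of the gradient of the constraint function. -/
noncomputable def gradConstr (i : V) : Action G i :=
  ((Fintype.card V : ℝ) / P.delta i t * constr (d i) (s.query P t u i)) • u i

/-- Dual variable of round `t + 1`. -/
noncomputable def nextDual (i : V) : ℝ :=
  max (s.dual i + P.gamma i (t + 1) *
    (constr (d i) (s.played P t d u i) - P.beta i (t + 1) * s.dual i)) 0

/-- Surrogate loss of round `t`. -/
noncomputable def surrogate (i : V) (y : Action G i) : ℝ :=
  inner ℝ (s.gradLoss P t l d u i) (y - s.center i)

/-- Passage from round `t` to round `t + 1`. -/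
noncomputable def next : State G K where
  point i k := proj ((1 - P.xi i (t + 1)) • P.X i)
    (s.point i k - P.eta i k (t + 1) •
      (s.gradLoss P t l d u i + s.nextDual P t d u i • s.gradConstr P t d u i))
  weight i k :=
    s.weight i k * Real.exp (-ε * s.surrogate P t l d u i (s.point i k)) /
      ∑ k', s.weight i k' * Real.exp (-ε * s.surrogate P t l d u i (s.point i k'))
  dual i := s.nextDual P t d u i

end State

/-- `run … n` is the state at the beginning of round `n + 1`. -/
noncomputable def run (P : Params G) (K : ℕ) (ε : ℝ) (l d : ℕ → V → ℝ)
    (u : ℕ → ∀ i, Action G i) (z₀ : ∀ i, Action G i) : ℕ → State G K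
  | 0 => State.init K z₀
  | n + 1 => (run P K ε l d u z₀ n).next P ε (n + 1) (l (n + 1)) (d (n + 1)) (u (n + 1))

/-- Cumulative loss of node `i` over rounds `1, …, T`. -/
noncomputable def cumLoss (P : Params G) (ε : ℝ) (l d : ℕ → V → ℝ)
    (u : ℕ → ∀ i, Action G i) (z₀ : ∀ i, Action G i) (T : ℕ) (i : V) : ℝ :=
  ∑ n ∈ Finset.range T,
    let s := run P (numExperts T) ε l d u z₀ n
    s.ownLoss P (n + 1) (l (n + 1)) (d (n + 1)) (u (n + 1)) i (s.query P (n + 1) (u (n + 1)) i)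

/-- Cumulative loss over rounds `1, …, T` of the best fixed action of node `i` in hindsight. -/
noncomputable def bestLoss (P : Params G) (ε : ℝ) (l d : ℕ → V → ℝ)
    (u : ℕ → ∀ i, Action G i) (z₀ : ∀ i, Action G i) (T : ℕ) (i : V) : ℝ :=
  ⨅ y : P.X i, ∑ n ∈ Finset.range T,
    (run P (numExperts T) ε l d u z₀ n).ownLoss P (n + 1) (l (n + 1)) (d (n + 1)) (u (n + 1))
      i (y : Action G i)

end Network

/-- The uniform distribution on the unit sphere. -/
noncomputable def uniformSphere (E : Type*) [NormedAddCommGroup E] [InnerProductSpace ℝ E]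
    [FiniteDimensional ℝ E] [MeasurableSpace E] [BorelSpace E] :
    Measure (Metric.sphere (0 : E) 1) :=
  ((volume : Measure E).toSphere Set.univ)⁻¹ • (volume : Measure E).toSphere

section Environment

variable {V : Type*} [Fintype V] [DecidableEq V] {G : SimpleGraph V} [DecidableRel G.Adj]

variable (G) in
/-- The environment and the random inputs of the algorithm on a probability space: demands `l`,
random generations `d`, exploration directions `u`, and initial points `z₀`. -/
structure Environment (Ω : Type*) where
  l : ℕ → V → ℝ
  d : ℕ → V → Ω → ℝ
  u : ℕ → ∀ i, Ω → Metric.sphere (0 : Action G i) 1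
  z₀ : ∀ i, Ω → Action G i

/-- The assumptions on the environment and on the random inputs. -/
structure Environment.Valid {Ω : Type*} [MeasurableSpace Ω] (ℰ : Environment G Ω) (P : Params G)
    (μ : Measure Ω) : Prop where
  measurable_d : ∀ t i, Measurable (ℰ.d t i)
  measurable_u : ∀ t i, Measurable (ℰ.u t i)
  measurable_z₀ : ∀ i, Measurable (ℰ.z₀ i)
  demand : ∀ t i, 1 / P.L ≤ ℰ.l t i
  generation : ∀ t i, ∀ᵐ ω ∂μ, 0 ≤ ℰ.d t i ω
  loss_bound : ∀ t i, ∀ x : ∀ k, Action G k, (∀ k, x k ∈ P.X k) → |loss (ℰ.l t) x i| ≤ P.F i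
  constr_bound : ∀ t i, ∀ᵐ ω ∂μ, ∀ y ∈ P.X i, |constr (ℰ.d t i ω) y| ≤ P.B i
  start : ∀ i, ∀ᵐ ω ∂μ, ℰ.z₀ i ω ∈ (1 - P.xi i 1) • P.X i
  uniform_u : ∀ t i, μ.map (ℰ.u t i) = uniformSphere (Action G i)
  indep_u : iIndepFun (fun (p : ℕ × V) ω => ℰ.u p.1 p.2 ω) μ
  indep_env : IndepFun (fun ω => ((fun t i => ℰ.d t i ω), (fun i => ℰ.z₀ i ω)))
    (fun ω t i => ℰ.u t i ω) μ

namespace Environment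

variable {Ω : Type*} (ℰ : Environment G Ω) (P : Params G) (ε : ℝ) (T : ℕ) (i : V)

/-- Cumulative loss of node `i` as a random variable. -/
noncomputable def algLoss (ω : Ω) : ℝ :=
  cumLoss P ε ℰ.l (fun t k => ℰ.d t k ω) (fun t k => (ℰ.u t k ω : Action G k))
    (fun k => ℰ.z₀ k ω) T i

/-- Best cumulative loss in hindsight of node `i` as a random variable. -/
noncomputable def minLoss (ω : Ω) : ℝ :=
  bestLoss P ε ℰ.l (fun t k => ℰ.d t k ω) (fun t k => (ℰ.u t k ω : Action G k))
    (fun k => ℰ.z₀ k ω) T i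

/-- Static regret of node `i`. -/
noncomputable def staticRegret [MeasurableSpace Ω] (μ : Measure Ω) : ℝ :=
  ∫ ω, ℰ.algLoss P ε T i ω ∂μ - ∫ ω, ℰ.minLoss P ε T i ω ∂μ

end Environment

end Environment

end EnergySharing

/-!
The loss of a node is, up to an additive constant, a sum of convex Lipschitz functions of the single
coordinates of its own allocation. Reflecting one coordinate of the exploration direction therefore
turns the mean of the one-point estimate into symmetric difference quotients, so that up to the
factor `|closed neighbourhood| / N` the conditional mean of the estimate is a subgradient with error
`O(δ)`. The played actions satisfy the generation constraint, so the dual variables stay zero. The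
first expert has step sizes of order `t ^ (-3 / 4)` and initial weight at least `1 / 2`; projected
descent gives it regret `O(T ^ (3 / 4))` with respect to the estimates, and with a learning rate of
order `T ^ (-3 / 4)` the weighted mean follows it at the same cost.

It remains to pass from the estimates to their conditional means. The comparator is chosen after the
fact, so the errors are not centered against it; but they are orthogonal in `L²` and of size
`O(t ^ (1 / 4))`, hence their sum has mean norm `O(T ^ (1 / 2) * T ^ (1 / 4))`.
-/

namespace EnergySharing

section Projection

variable {E : Type*} [NormedAddCommGroup E] [InnerProductSpace ℝ E] {C : Set E}

theorem proj_mem_and_dist_proj_le (hne : C.Nonempty) (hC : IsComplete C) (hconv : Convex ℝ C)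
    (x : E) : proj C x ∈ C ∧ ∀ y ∈ C, dist x (proj C x) ≤ dist x y := by
  obtain ⟨p, hp, hnorm⟩ := exists_norm_eq_iInf_of_complete_convex hne hC hconv x
  refine Classical.epsilon_spec (p := fun p => p ∈ C ∧ ∀ y ∈ C, dist x p ≤ dist x y)
    ⟨p, hp, fun y hy => ?_⟩
  rw [dist_eq_norm, dist_eq_norm, hnorm]
  exact ciInf_le (f := fun w : C => ‖x - w‖) ⟨0, by rintro _ ⟨w, rfl⟩; positivity⟩ ⟨y, hy⟩

theorem proj_mem (hne : C.Nonempty) (hC : IsComplete C) (hconv : Convex ℝ C) (x : E) :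
    proj C x ∈ C :=
  (proj_mem_and_dist_proj_le hne hC hconv x).1

theorem inner_sub_proj_sub_proj_nonpos (hC : IsComplete C) (hconv : Convex ℝ C) (x : E) {y : E}
    (hy : y ∈ C) : inner ℝ (x - proj C x) (y - proj C x) ≤ 0 := by
  obtain ⟨hp, hmin⟩ := proj_mem_and_dist_proj_le ⟨y, hy⟩ hC hconv x
  refine (norm_eq_iInf_iff_real_inner_le_zero hconv hp).1 ?_ y hy
  have : Nonempty C := ⟨⟨y, hy⟩⟩
  refine le_antisymm (le_ciInf fun w => ?_)
    (ciInf_le (f := fun w : C => ‖x - w‖) ⟨0, by rintro _ ⟨w, rfl⟩; positivity⟩ ⟨_, hp⟩)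
  simpa only [dist_eq_norm] using hmin w w.2

theorem norm_proj_sub_le (hC : IsComplete C) (hconv : Convex ℝ C) (x : E) {y : E} (hy : y ∈ C) :
    ‖proj C x - y‖ ≤ ‖x - y‖ := by
  have hobtuse := inner_sub_proj_sub_proj_nonpos hC hconv x hy
  have hsplit := norm_sub_sq_real (x - proj C x) (y - proj C x)
  rw [sub_sub_sub_cancel_right, norm_sub_rev y] at hsplit
  refine le_of_sq_le_sq ?_ (norm_nonneg _)
  linarith [sq_nonneg ‖x - proj C x‖]

theorem lipschitzWith_proj (hne : C.Nonempty) (hC : IsComplete C) (hconv : Convex ℝ C) :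
    LipschitzWith 1 (proj C) := by
  refine LipschitzWith.of_dist_le_mul fun x y => ?_
  have hx := inner_sub_proj_sub_proj_nonpos hC hconv x (proj_mem hne hC hconv y)
  have hy := inner_sub_proj_sub_proj_nonpos hC hconv y (proj_mem hne hC hconv x)
  set p := proj C x
  set q := proj C y
  have hfirm : ‖p - q‖ * ‖p - q‖ ≤ ‖x - y‖ * ‖p - q‖ := by
    refine le_trans ?_ (real_inner_le_norm (x - y) (p - q))
    rw [← real_inner_self_eq_norm_mul_norm]
    have hsum : inner ℝ (x - p) (q - p) + inner ℝ (y - q) (p - q) =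
        inner ℝ (p - q) (p - q) - inner ℝ (x - y) (p - q) := by
      rw [← neg_sub p q, inner_neg_right, neg_add_eq_sub, ← inner_sub_left, ← inner_sub_left]
      congr 1
      abel
    linarith
  rw [dist_eq_norm, dist_eq_norm, NNReal.coe_one, one_mul]
  rcases (norm_nonneg (p - q)).eq_or_lt with hzero | hpos
  · rw [← hzero]
    positivity
  · exact le_of_mul_le_mul_right hfirm hpos

end Projection

section GradientDescent

theorem sum_sub_succ_div_le {A η : ℕ → ℝ} {B : ℝ} (hA : ∀ n, 0 ≤ A n) (hAB : ∀ n, A n ≤ B)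
    (hη : ∀ n, 0 < η n) (hanti : Antitone η) (T : ℕ) :
    ∑ n ∈ Finset.range T, (A n - A (n + 1)) / η n ≤ B / η T := by
  have htelescope : ∑ n ∈ Finset.range T, (A n - A (n + 1)) / η n ≤ (B - A T) / η T := by
    induction T with
    | zero => simpa using div_nonneg (sub_nonneg.2 (hAB 0)) (hη 0).le
    | succ T ih =>
      calc ∑ n ∈ Finset.range (T + 1), (A n - A (n + 1)) / η n
          ≤ (B - A T) / η T + (A T - A (T + 1)) / η T := by
            rw [Finset.sum_range_succ]
            gcongr
        _ = (B - A (T + 1)) / η T := by ring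
        _ ≤ (B - A (T + 1)) / η (T + 1) :=
            div_le_div_of_nonneg_left (sub_nonneg.2 (hAB _)) (hη _) (hanti T.le_succ)
  refine htelescope.trans ?_
  have := hη T
  gcongr
  linarith [hA T]

variable {E : Type*} [NormedAddCommGroup E] [InnerProductSpace ℝ E]

theorem two_mul_inner_sub_le_of_proj {C : Set E} (hC : IsComplete C) (hconv : Convex ℝ C)
    (z g : E) (η : ℝ) {c : E} (hc : c ∈ C) :
    2 * η * inner ℝ g (z - c) ≤
      ‖z - c‖ ^ 2 - ‖proj C (z - η • g) - c‖ ^ 2 + η ^ 2 * ‖g‖ ^ 2 := by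
  have hproj := pow_le_pow_left₀ (norm_nonneg _) (norm_proj_sub_le hC hconv (z - η • g) hc) 2
  have hexpand : ‖z - η • g - c‖ ^ 2 =
      ‖z - c‖ ^ 2 - 2 * η * inner ℝ g (z - c) + η ^ 2 * ‖g‖ ^ 2 := by
    rw [sub_right_comm, norm_sub_sq_real, inner_smul_right, real_inner_comm, norm_smul, mul_pow,
      Real.norm_eq_abs, sq_abs]
    ring
  linarith

theorem sum_inner_sub_comparator_le {C : ℕ → Set E} (hC : ∀ n, IsComplete (C n))
    (hconv : ∀ n, Convex ℝ (C n)) {z c g : ℕ → E} {η : ℕ → ℝ} {D W : ℝ}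
    (hstep : ∀ n, z (n + 1) = proj (C (n + 1)) (z n - η n • g n))
    (hc : ∀ n, c n ∈ C n) (hη : ∀ n, 0 < η n) (hanti : Antitone η)
    (hD : ∀ n m, ‖z n - c m‖ ≤ D)
    (hW : ∀ n, ∑ k ∈ Finset.range n, ‖c k - c (k + 1)‖ ≤ W) (T : ℕ) :
    ∑ n ∈ Finset.range T, inner ℝ (g n) (z n - c (n + 1)) ≤
      (D ^ 2 + 2 * D * W) / (2 * η T) + ∑ n ∈ Finset.range T, η n / 2 * ‖g n‖ ^ 2 := by
  have hD0 : 0 ≤ D := (norm_nonneg _).trans (hD 0 0)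
  -- The potential charges the drift of the comparator to its remaining path length.
  let A : ℕ → ℝ := fun n =>
    ‖z n - c n‖ ^ 2 + 2 * D * (W - ∑ k ∈ Finset.range n, ‖c k - c (k + 1)‖)
  have hA : ∀ n, 0 ≤ A n := fun n =>
    add_nonneg (sq_nonneg _) (mul_nonneg (by positivity) (sub_nonneg.2 (hW n)))
  have hAB : ∀ n, A n ≤ D ^ 2 + 2 * D * W := fun n => by
    have hpath : 0 ≤ ∑ k ∈ Finset.range n, ‖c k - c (k + 1)‖ :=
      Finset.sum_nonneg fun _ _ => norm_nonneg _
    have hsq : ‖z n - c n‖ ^ 2 ≤ D ^ 2 := pow_le_pow_left₀ (norm_nonneg _) (hD n n) 2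
    have := mul_nonneg hD0 hpath
    simp only [A]
    linarith
  have hround : ∀ n, inner ℝ (g n) (z n - c (n + 1)) ≤
      (A n - A (n + 1)) / (2 * η n) + η n / 2 * ‖g n‖ ^ 2 := fun n => by
    have hdescent :=
      two_mul_inner_sub_le_of_proj (hC _) (hconv _) (z n) (g n) (η n) (hc (n + 1))
    rw [← hstep n] at hdescent
    have hdrift : ‖z n - c (n + 1)‖ ^ 2 ≤ ‖z n - c n‖ ^ 2 + 2 * D * ‖c n - c (n + 1)‖ := by
      have htri := norm_sub_le_norm_sub_add_norm_sub (z n) (c n) (c (n + 1))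
      nlinarith [hD n n, hD n (n + 1), norm_nonneg (z n - c n), norm_nonneg (c n - c (n + 1)),
        norm_nonneg (z n - c (n + 1))]
    have hpos := hη n
    have hcombine : (A n - A (n + 1)) / (2 * η n) + η n / 2 * ‖g n‖ ^ 2 =
        (A n - A (n + 1) + η n ^ 2 * ‖g n‖ ^ 2) / (2 * η n) := by
      field_simp
    rw [hcombine, le_div_iff₀ (by positivity)]
    simp only [A, Finset.sum_range_succ]
    linarith
  refine (Finset.sum_le_sum fun n _ => hround n).trans ?_
  rw [Finset.sum_add_distrib]
  gcongr
  exact sum_sub_succ_div_le hA hAB (fun n => mul_pos two_pos (hη n))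
    (hanti.const_mul zero_le_two) T

end GradientDescent

section ExponentialWeights

variable {ι : Type*} [Fintype ι]

/-- One step of the exponential weights method with learning rate `ε`: the weights `w` after the
losses `x` have been observed. -/
noncomputable def exponentialUpdate (ε : ℝ) (w x : ι → ℝ) (k : ι) : ℝ :=
  w k * Real.exp (-ε * x k) / ∑ k', w k' * Real.exp (-ε * x k')

theorem sum_mul_exp_pos [Nonempty ι] (ε : ℝ) {w : ι → ℝ} (hw : ∀ k, 0 < w k) (x : ι → ℝ) :
    0 < ∑ k, w k * Real.exp (-ε * x k) :=
  Finset.sum_pos (fun k _ => mul_pos (hw k) (Real.exp_pos _)) Finset.univ_nonempty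

theorem exponentialUpdate_pos (ε : ℝ) {w : ι → ℝ} (hw : ∀ k, 0 < w k) (x : ι → ℝ) (k : ι) :
    0 < exponentialUpdate ε w x k :=
  have : Nonempty ι := ⟨k⟩
  div_pos (mul_pos (hw k) (Real.exp_pos _)) (sum_mul_exp_pos ε hw x)

theorem sum_exponentialUpdate [Nonempty ι] (ε : ℝ) {w : ι → ℝ} (hw : ∀ k, 0 < w k)
    (x : ι → ℝ) : ∑ k, exponentialUpdate ε w x k = 1 := by
  simp only [exponentialUpdate, ← Finset.sum_div]
  exact div_self (sum_mul_exp_pos ε hw x).ne'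

theorem log_exponentialUpdate (ε : ℝ) {w : ι → ℝ} (hw : ∀ k, 0 < w k) (x : ι → ℝ) (k : ι) :
    Real.log (exponentialUpdate ε w x k) =
      Real.log (w k) - ε * x k - Real.log (∑ k', w k' * Real.exp (-ε * x k')) := by
  have : Nonempty ι := ⟨k⟩
  rw [exponentialUpdate, Real.log_div (mul_pos (hw k) (Real.exp_pos _)).ne'
    (sum_mul_exp_pos ε hw x).ne', Real.log_mul (hw k).ne' (Real.exp_pos _).ne', Real.log_exp,
    neg_mul, ← sub_eq_add_neg]

theorem exp_le_add_exp_sq (x : ℝ) : Real.exp x ≤ x + Real.exp (x ^ 2) := by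
  have hsq := Real.add_one_le_exp (x ^ 2)
  rcases le_total |x| 1 with hx | hx
  · linarith [le_of_abs_le (Real.abs_exp_sub_one_sub_id_le hx)]
  · rcases le_abs'.1 hx with hneg | hpos
    · nlinarith [Real.exp_le_one_iff.2 (hneg.trans neg_one_lt_zero.le)]
    · linarith [Real.exp_le_exp.2 (show x ≤ x ^ 2 by nlinarith)]

theorem log_sum_mul_exp_le {w x : ι → ℝ} {M : ℝ} (ε : ℝ) (hw : ∀ k, 0 < w k)
    (hsum : ∑ k, w k = 1) (hcenter : ∑ k, w k * x k = 0) (hM : ∀ k, |x k| ≤ M) :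
    Real.log (∑ k, w k * Real.exp (-ε * x k)) ≤ ε ^ 2 * M ^ 2 := by
  have : Nonempty ι := by
    by_contra hempty
    rw [not_nonempty_iff] at hempty
    simp at hsum
  rw [Real.log_le_iff_le_exp (sum_mul_exp_pos ε hw x)]
  have hterm : ∀ k, Real.exp (-ε * x k) ≤ -ε * x k + Real.exp (ε ^ 2 * M ^ 2) := fun k => by
    refine (exp_le_add_exp_sq _).trans ?_
    rw [mul_pow, neg_sq, ← sq_abs (x k)]
    have := hM k
    gcongr
  calc ∑ k, w k * Real.exp (-ε * x k)
      ≤ ∑ k, w k * (-ε * x k + Real.exp (ε ^ 2 * M ^ 2)) :=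
        Finset.sum_le_sum fun k _ => mul_le_mul_of_nonneg_left (hterm k) (hw k).le
    _ = -ε * ∑ k, w k * x k + (∑ k, w k) * Real.exp (ε ^ 2 * M ^ 2) := by
        rw [Finset.mul_sum, Finset.sum_mul, ← Finset.sum_add_distrib]
        exact Finset.sum_congr rfl fun k _ => by ring
    _ = Real.exp (ε ^ 2 * M ^ 2) := by rw [hcenter, hsum, mul_zero, zero_add, one_mul]

theorem sum_neg_le_of_exponentialUpdate {w x : ℕ → ι → ℝ} {ε M : ℝ} (hε : 0 < ε)
    (hw : ∀ n k, 0 < w n k) (hsum : ∀ n, ∑ k, w n k = 1)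
    (hstep : ∀ n, w (n + 1) = exponentialUpdate ε (w n) (x n))
    (hcenter : ∀ n, ∑ k, w n k * x n k = 0) (T : ℕ) (hM : ∀ n < T, ∀ k, |x n k| ≤ M) (k : ι) :
    ∑ n ∈ Finset.range T, -x n k ≤ -Real.log (w 0 k) / ε + T * (ε * M ^ 2) := by
  have hround : ∀ n ∈ Finset.range T,
      ε * -x n k ≤ Real.log (w (n + 1) k) - Real.log (w n k) + ε ^ 2 * M ^ 2 := fun n hn => by
    rw [hstep, log_exponentialUpdate ε (hw n)]
    linarith [log_sum_mul_exp_le ε (hw n) (hsum n) (hcenter n) (hM n (Finset.mem_range.1 hn))]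
  have htotal := Finset.sum_le_sum hround
  rw [← Finset.mul_sum, Finset.sum_add_distrib,
    Finset.sum_range_sub (fun n => Real.log (w n k)), Finset.sum_const, Finset.card_range,
    nsmul_eq_mul] at htotal
  have hlast : Real.log (w T k) ≤ 0 := by
    refine Real.log_nonpos (hw T k).le ?_
    rw [← hsum T]
    exact Finset.single_le_sum (fun k _ => (hw T k).le) (Finset.mem_univ k)
  rw [div_add' _ _ _ hε.ne', le_div_iff₀ hε]
  linarith

end ExponentialWeights

section SymmetricDifference

open scoped NNReal

theorem symm_diff_quotient_mul_sub_le {φ : ℝ → ℝ} (hφ : ConvexOn ℝ Set.univ φ) {K : ℝ≥0}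
    (hK : LipschitzWith K φ) (z x : ℝ) {h : ℝ} (hh : h ≠ 0) :
    (φ (z + h) - φ (z - h)) / (2 * h) * (x - z) ≤ φ x - φ z + 2 * K * |h| := by
  wlog hpos : 0 < h generalizing h
  · have hflip := this (neg_ne_zero.2 hh) (neg_pos.2 (lt_of_le_of_ne (not_lt.1 hpos) hh))
    rw [← sub_eq_add_neg, sub_neg_eq_add, abs_neg, mul_neg, div_neg, ← neg_div, neg_sub] at hflip
    exact hflip
  have hshift : ∀ a b s : ℝ, |s| = h → φ (a + s) - φ (b + s) ≤ φ a - φ b + 2 * K * h :=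
    fun a b s hs => by
      have ha := (le_abs_self _).trans (hK.dist_le_mul (a + s) a)
      have hb := (le_abs_self _).trans (hK.dist_le_mul b (b + s))
      rw [Real.dist_eq, add_sub_cancel_left, hs] at ha
      rw [Real.dist_eq, sub_add_cancel_left, abs_neg, hs] at hb
      linarith
  rw [abs_of_pos hpos]
  rcases lt_trichotomy z x with hzx | rfl | hxz
  · have hslope := hφ.slope_mono_adjacent (Set.mem_univ (z - h)) (Set.mem_univ (x + h))
      (show z - h < z + h by linarith) (by linarith)
    rw [show z + h - (z - h) = 2 * h by ring, add_sub_add_right_eq_sub,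
      le_div_iff₀ (sub_pos.2 hzx)] at hslope
    exact hslope.trans (hshift x z h (abs_of_pos hpos))
  · simpa using mul_nonneg (mul_nonneg zero_le_two K.coe_nonneg) hpos.le
  · have hslope := hφ.slope_mono_adjacent (Set.mem_univ (x - h)) (Set.mem_univ (z + h))
      (show x - h < z - h by linarith) (by linarith)
    rw [show z + h - (z - h) = 2 * h by ring, sub_sub_sub_cancel_right,
      div_le_iff₀ (sub_pos.2 hxz)] at hslope
    have hleft := hshift x z (-h) (by rw [abs_neg, abs_of_pos hpos])
    rw [← sub_eq_add_neg, ← sub_eq_add_neg] at hleft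
    linarith

end SymmetricDifference

end EnergySharing

namespace EnergySharing

section Sphere

variable {E : Type*} [NormedAddCommGroup E] [InnerProductSpace ℝ E]

/-- The homeomorphism of the unit sphere induced by a linear isometry. -/
def sphereHomeomorph (f : E ≃ₗᵢ[ℝ] E) :
    Metric.sphere (0 : E) 1 ≃ₜ Metric.sphere (0 : E) 1 :=
  f.toHomeomorph.subtype fun x => by simp

@[simp]
theorem coe_sphereHomeomorph (f : E ≃ₗᵢ[ℝ] E) (u : Metric.sphere (0 : E) 1) :
    (sphereHomeomorph f u : E) = f u :=
  rfl

theorem smul_image_preimage_sphereHomeomorph (f : E ≃ₗᵢ[ℝ] E) (I : Set ℝ)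
    (s : Set (Metric.sphere (0 : E) 1)) :
    I • (Subtype.val '' (sphereHomeomorph f ⁻¹' s)) = f ⁻¹' (I • (Subtype.val '' s)) := by
  ext x
  simp only [Set.mem_smul, Set.mem_image, Set.mem_preimage]
  constructor
  · rintro ⟨r, hr, _, ⟨u, hu, rfl⟩, rfl⟩
    exact ⟨r, hr, _, ⟨_, hu, rfl⟩, by rw [map_smul, coe_sphereHomeomorph]⟩
  · rintro ⟨r, hr, _, ⟨u, hu, rfl⟩, hx⟩
    obtain ⟨v, rfl⟩ := (sphereHomeomorph f).surjective u
    exact ⟨r, hr, _, ⟨v, hu, rfl⟩, f.injective (by rw [map_smul, ← hx, coe_sphereHomeomorph])⟩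

variable [FiniteDimensional ℝ E] [MeasurableSpace E] [BorelSpace E]

theorem measurePreserving_sphereHomeomorph (f : E ≃ₗᵢ[ℝ] E) :
    MeasurePreserving (sphereHomeomorph f) (uniformSphere E) (uniformSphere E) := by
  have hmeas : Measurable (sphereHomeomorph f) := (sphereHomeomorph f).continuous.measurable
  have hmap : ((volume : Measure E).toSphere).map (sphereHomeomorph f) =
      (volume : Measure E).toSphere := by
    ext s hs
    rw [Measure.map_apply hmeas hs, Measure.toSphere_apply' _ (hmeas hs),
      Measure.toSphere_apply' _ hs, smul_image_preimage_sphereHomeomorph,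
      f.measurePreserving.measure_preimage_emb f.toHomeomorph.measurableEmbedding]
  exact ⟨hmeas, by rw [uniformSphere, Measure.map_smul, hmap]⟩

theorem integral_sphere_comp_isometry (f : E ≃ₗᵢ[ℝ] E) (h : E → ℝ) :
    ∫ u : Metric.sphere (0 : E) 1, h (f u) ∂uniformSphere E =
      ∫ u : Metric.sphere (0 : E) 1, h u ∂uniformSphere E :=
  (measurePreserving_sphereHomeomorph f).integral_comp (sphereHomeomorph f).measurableEmbedding
    (fun u : Metric.sphere (0 : E) 1 => h u)

variable [Nontrivial E]

instance isProbabilityMeasure_uniformSphere : IsProbabilityMeasure (uniformSphere E) := by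
  refine ⟨?_⟩
  rw [uniformSphere, Measure.smul_apply, smul_eq_mul]
  refine ENNReal.inv_mul_cancel ?_ (measure_ne_top _ _)
  rw [ne_eq, Measure.measure_univ_eq_zero]
  exact Measure.toSphere_ne_zero _

theorem integrable_uniformSphere_of_continuous {F : Type*} [NormedAddCommGroup F]
    {h : Metric.sphere (0 : E) 1 → F} (hh : Continuous h) : Integrable h (uniformSphere E) :=
  hh.integrable_of_hasCompactSupport (HasCompactSupport.of_compactSpace _)

/-- The mean of the one-point estimate `f (z + δ u) / δ • u`, for `u` uniform on the unit sphere.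
Up to the factor `dim E` it is the gradient at `z` of the average of `f` over the ball of
radius `δ`. -/
noncomputable def sphericalGradient (δ : ℝ) (f : E → ℝ) (z : E) : E :=
  ∫ u : Metric.sphere (0 : E) 1, (f (z + δ • (u : E)) / δ) • (u : E) ∂uniformSphere E

end Sphere

section SeparableGradient

open scoped NNReal

variable {ι : Type*} [Fintype ι]

theorem continuous_of_eq_add_sum {f : EuclideanSpace ℝ ι → ℝ} {φ : ι → ℝ → ℝ} {A : ℝ}
    (hf : ∀ y, f y = A + ∑ j, φ j (y j)) (hφ : ∀ j, Continuous (φ j)) : Continuous f := by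
  rw [funext hf]
  fun_prop

theorem integral_sphere_coord_sq [Nontrivial (EuclideanSpace ℝ ι)] (k : ι) :
    ∫ u : Metric.sphere (0 : EuclideanSpace ℝ ι) 1, (u : EuclideanSpace ℝ ι) k ^ 2
      ∂uniformSphere (EuclideanSpace ℝ ι) = 1 / Fintype.card ι := by
  classical
  set moment : ι → ℝ := fun k => ∫ u : Metric.sphere (0 : EuclideanSpace ℝ ι) 1,
    (u : EuclideanSpace ℝ ι) k ^ 2 ∂uniformSphere (EuclideanSpace ℝ ι) with hmoment
  have hsymm : ∀ j, moment j = moment k := fun j => by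
    have := integral_sphere_comp_isometry
      (LinearIsometryEquiv.piLpCongrLeft 2 ℝ ℝ (Equiv.swap j k)) (fun x => x k ^ 2)
    simpa [LinearIsometryEquiv.piLpCongrLeft_apply, Equiv.piCongrLeft'] using this
  have hsum : ∑ j, moment j = 1 := by
    have hnorm : ∀ u : Metric.sphere (0 : EuclideanSpace ℝ ι) 1,
        ∑ j, (u : EuclideanSpace ℝ ι) j ^ 2 = 1 := fun u => by
      rw [← EuclideanSpace.real_norm_sq_eq, norm_eq_of_mem_sphere, one_pow]
    simp only [hmoment]
    rw [← integral_finsetSum _ fun j _ => integrable_uniformSphere_of_continuous (by fun_prop)]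
    simp only [hnorm, integral_const, probReal_univ, one_smul]
  simp only [hsymm, Finset.sum_const, Finset.card_univ, nsmul_eq_mul] at hsum
  exact eq_one_div_of_mul_eq_one_right hsum

/-- The isometry of Euclidean space that reverses the sign of the coordinate `k`. -/
noncomputable def reflectCoord [DecidableEq ι] (k : ι) :
    EuclideanSpace ℝ ι ≃ₗᵢ[ℝ] EuclideanSpace ℝ ι :=
  LinearIsometryEquiv.piLpCongrRight 2 fun j =>
    if j = k then LinearIsometryEquiv.neg ℝ else LinearIsometryEquiv.refl ℝ ℝ

theorem reflectCoord_apply [DecidableEq ι] (k : ι) (x : EuclideanSpace ℝ ι) (j : ι) :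
    reflectCoord k x j = if j = k then -x j else x j := by
  simp only [reflectCoord, LinearIsometryEquiv.piLpCongrRight_apply]
  split_ifs <;> simp

theorem sub_reflectCoord_of_separable [DecidableEq ι] {f : EuclideanSpace ℝ ι → ℝ}
    {φ : ι → ℝ → ℝ} {A : ℝ} (hf : ∀ y, f y = A + ∑ j, φ j (y j)) (k : ι) (δ : ℝ)
    (z u : EuclideanSpace ℝ ι) :
    f (z + δ • u) - f (z + δ • reflectCoord k u) =
      φ k (z k + δ * u k) - φ k (z k - δ * u k) := by
  rw [hf, hf, add_sub_add_left_eq_sub, ← Finset.sum_sub_distrib, Finset.sum_eq_single k]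
  · simp [reflectCoord_apply, sub_eq_add_neg]
  · intro j _ hj
    simp [reflectCoord_apply, hj]
  · simp

variable [Nontrivial (EuclideanSpace ℝ ι)]

theorem sphericalGradient_apply {f : EuclideanSpace ℝ ι → ℝ} (hf : Continuous f) (δ : ℝ)
    (z : EuclideanSpace ℝ ι) (k : ι) :
    sphericalGradient δ f z k = ∫ u : Metric.sphere (0 : EuclideanSpace ℝ ι) 1,
      f (z + δ • (u : EuclideanSpace ℝ ι)) / δ * (u : EuclideanSpace ℝ ι) k
        ∂uniformSphere (EuclideanSpace ℝ ι) :=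
  ((EuclideanSpace.proj (𝕜 := ℝ) k).integral_comp_comm
    (integrable_uniformSphere_of_continuous (by fun_prop))).symm

theorem two_mul_sphericalGradient_apply_of_separable {f : EuclideanSpace ℝ ι → ℝ}
    {φ : ι → ℝ → ℝ} {A : ℝ} (hf : ∀ y, f y = A + ∑ j, φ j (y j)) (hφ : ∀ j, Continuous (φ j))
    (δ : ℝ) (z : EuclideanSpace ℝ ι) (k : ι) :
    2 * sphericalGradient δ f z k = ∫ u : Metric.sphere (0 : EuclideanSpace ℝ ι) 1,
      (φ k (z k + δ * (u : EuclideanSpace ℝ ι) k) - φ k (z k - δ * (u : EuclideanSpace ℝ ι) k)) / δ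
        * (u : EuclideanSpace ℝ ι) k ∂uniformSphere (EuclideanSpace ℝ ι) := by
  classical
  have hcont := continuous_of_eq_add_sum hf hφ
  have hreflected := integral_sphere_comp_isometry (reflectCoord k)
    (fun u => f (z + δ • u) / δ * u k)
  rw [← sphericalGradient_apply hcont] at hreflected
  rw [two_mul]
  nth_rewrite 1 [sphericalGradient_apply hcont]
  rw [← hreflected, ← integral_add (integrable_uniformSphere_of_continuous (by fun_prop))
    (integrable_uniformSphere_of_continuous (by fun_prop))]
  congr 1 with u
  rw [← sub_reflectCoord_of_separable hf, reflectCoord_apply, if_pos rfl]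
  ring

theorem symm_diff_mul_sub_le {φ : ℝ → ℝ} (hφ : ConvexOn ℝ Set.univ φ) {K : ℝ≥0}
    (hK : LipschitzWith K φ) {δ : ℝ} (hδ : 0 < δ) (z x : ℝ) {a : ℝ} (ha : |a| ≤ 1) :
    (φ (z + δ * a) - φ (z - δ * a)) / δ * a * (x - z) ≤
      2 * (φ x - φ z + 2 * K * δ) * a ^ 2 := by
  rcases eq_or_ne a 0 with rfl | ha0
  · simp
  calc (φ (z + δ * a) - φ (z - δ * a)) / δ * a * (x - z)
      = 2 * a ^ 2 * ((φ (z + δ * a) - φ (z - δ * a)) / (2 * (δ * a)) * (x - z)) := by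
        field_simp
    _ ≤ 2 * a ^ 2 * (φ x - φ z + 2 * K * |δ * a|) := by
        gcongr
        exact symm_diff_quotient_mul_sub_le hφ hK z x (mul_ne_zero hδ.ne' ha0)
    _ ≤ 2 * a ^ 2 * (φ x - φ z + 2 * K * δ) := by
        rw [abs_mul, abs_of_pos hδ]
        gcongr
        exact mul_le_of_le_one_right hδ.le ha
    _ = 2 * (φ x - φ z + 2 * K * δ) * a ^ 2 := by ring

theorem card_mul_sphericalGradient_apply_mul_sub_le {f : EuclideanSpace ℝ ι → ℝ}
    {φ : ι → ℝ → ℝ} {A : ℝ} (hf : ∀ y, f y = A + ∑ j, φ j (y j))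
    (hφ : ∀ j, ConvexOn ℝ Set.univ (φ j)) {K : ℝ≥0} (hK : ∀ j, LipschitzWith K (φ j))
    {δ : ℝ} (hδ : 0 < δ) (z x : EuclideanSpace ℝ ι) (k : ι) :
    Fintype.card ι * (sphericalGradient δ f z k * (x k - z k)) ≤
      φ k (x k) - φ k (z k) + 2 * K * δ := by
  have hcont : ∀ j, Continuous (φ j) := fun j => (hK j).continuous
  have hcoord : ∀ u : Metric.sphere (0 : EuclideanSpace ℝ ι) 1,
      |(u : EuclideanSpace ℝ ι) k| ≤ 1 := fun u =>
    (PiLp.norm_apply_le (u : EuclideanSpace ℝ ι) k).trans_eq (norm_eq_of_mem_sphere u)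
  have hmono := integral_mono (μ := uniformSphere (EuclideanSpace ℝ ι))
    (integrable_uniformSphere_of_continuous (by fun_prop))
    (integrable_uniformSphere_of_continuous (by fun_prop))
    fun u : Metric.sphere (0 : EuclideanSpace ℝ ι) 1 =>
      symm_diff_mul_sub_le (hφ k) (hK k) hδ (z k) (x k) (hcoord u)
  rw [integral_mul_const, integral_const_mul, integral_sphere_coord_sq,
    ← two_mul_sphericalGradient_apply_of_separable hf hcont] at hmono
  have : Nonempty ι := ⟨k⟩
  have hcard : (0 : ℝ) < Fintype.card ι := Nat.cast_pos.2 Fintype.card_pos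
  rw [mul_one_div, le_div_iff₀ hcard] at hmono
  linarith

theorem card_mul_inner_sphericalGradient_le {f : EuclideanSpace ℝ ι → ℝ} {φ : ι → ℝ → ℝ}
    {A : ℝ} (hf : ∀ y, f y = A + ∑ j, φ j (y j)) (hφ : ∀ j, ConvexOn ℝ Set.univ (φ j))
    {K : ℝ≥0} (hK : ∀ j, LipschitzWith K (φ j)) {δ : ℝ} (hδ : 0 < δ)
    (z x : EuclideanSpace ℝ ι) :
    Fintype.card ι * inner ℝ (sphericalGradient δ f z) (x - z) ≤
      f x - f z + 2 * K * δ * Fintype.card ι := by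
  have hsum := Finset.sum_le_sum fun k (_ : k ∈ Finset.univ) =>
    card_mul_sphericalGradient_apply_mul_sub_le hf hφ hK hδ z x k
  rw [← Finset.mul_sum, Finset.sum_add_distrib, Finset.sum_sub_distrib, Finset.sum_const,
    Finset.card_univ, nsmul_eq_mul] at hsum
  rw [hf x, hf z, PiLp.inner_apply]
  simp only [PiLp.sub_apply, RCLike.inner_apply, conj_trivial, mul_comm (_ - _)]
  linarith

end SeparableGradient

end EnergySharing

namespace EnergySharing

section Resample

variable {A τ : Type*} {S : τ → Type*} [DecidableEq τ]

/-- Replace one coordinate of the second component. Integrating over the new coordinate takes the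
conditional expectation given everything else. -/
def resample (p : τ) (a : A × ∀ q, S q) (v : S p) : A × ∀ q, S q :=
  (a.1, Function.update a.2 p v)

variable [MeasurableSpace A] [∀ q, MeasurableSpace (S q)]

theorem measurable_resample (p : τ) :
    Measurable fun q : (A × ∀ q, S q) × S p => resample p q.1 q.2 := by
  refine measurable_fst.fst.prodMk (measurable_pi_iff.2 fun q => ?_)
  obtain rfl | hq := eq_or_ne q p
  · simpa only [Function.update_self] using measurable_snd
  · simp only [Function.update_of_ne hq]
    fun_prop

variable (ρ : ∀ q, Measure (S q)) [∀ q, IsProbabilityMeasure (ρ q)]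

theorem measurePreserving_update (p : τ) :
    MeasurePreserving (fun q : (∀ q, S q) × S p => Function.update q.1 p q.2)
      ((Measure.infinitePi ρ).prod (ρ p)) (Measure.infinitePi ρ) := by
  have hmeas : Measurable fun q : (∀ q, S q) × S p => Function.update q.1 p q.2 :=
    ((measurable_resample p).comp
      (((measurable_const (a := ())).prodMk measurable_fst).prodMk measurable_snd)).snd
  refine ⟨hmeas, Measure.eq_infinitePi _ fun s t ht => ?_⟩
  have hbox : MeasurableSet (Set.pi s t) := .pi s.countable_toSet fun q _ => ht q
  rw [Measure.map_apply hmeas hbox]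
  by_cases hp : p ∈ s
  · have hpre : (fun q : (∀ q, S q) × S p => Function.update q.1 p q.2) ⁻¹' Set.pi s t =
        Set.pi (s.erase p) t ×ˢ t p := by
      ext q
      simp only [Set.mem_preimage, Set.update_mem_pi_iff, Finset.mem_coe, hp, true_imp_iff,
        Set.mem_prod, Finset.coe_erase]
    rw [hpre, Measure.prod_prod, Measure.infinitePi_pi _ fun q _ => ht q,
      Finset.prod_erase_mul _ _ hp]
  · have hpre : (fun q : (∀ q, S q) × S p => Function.update q.1 p q.2) ⁻¹' Set.pi s t =
        Set.pi s t ×ˢ Set.univ := by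
      ext q
      simp only [Set.mem_preimage, Set.update_mem_pi_iff, Finset.mem_coe, hp, false_imp_iff,
        and_true, Set.mem_prod, Set.mem_univ, not_false_eq_true, Set.sdiff_singleton_eq_self]
    rw [hpre, Measure.prod_prod, Measure.infinitePi_pi _ fun q _ => ht q, measure_univ, mul_one]

variable (π : Measure A) [IsProbabilityMeasure π]

theorem measurePreserving_resample (p : τ) :
    MeasurePreserving (fun q : (A × ∀ q, S q) × S p => resample p q.1 q.2)
      ((π.prod (Measure.infinitePi ρ)).prod (ρ p)) (π.prod (Measure.infinitePi ρ)) :=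
  ((MeasurePreserving.id π).prod (measurePreserving_update ρ p)).comp
    (measurePreserving_prodAssoc π (Measure.infinitePi ρ) (ρ p))

variable {ρ π}

theorem integral_inner_integral_resample {E : Type*} [NormedAddCommGroup E]
    [InnerProductSpace ℝ E] [CompleteSpace E] (p : τ) {g Y : (A × ∀ q, S q) → E}
    (hg : Integrable g (π.prod (Measure.infinitePi ρ)))
    (hgY : Integrable (fun a => inner ℝ (g a) (Y a)) (π.prod (Measure.infinitePi ρ)))
    (hY : ∀ a v, Y (resample p a v) = Y a) :
    ∫ a, inner ℝ (∫ v, g (resample p a v) ∂ρ p) (Y a) ∂π.prod (Measure.infinitePi ρ) =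
      ∫ a, inner ℝ (g a) (Y a) ∂π.prod (Measure.infinitePi ρ) := by
  have hres := measurePreserving_resample ρ π p
  have hsection := (hres.integrable_comp_of_integrable hg).prod_right_ae
  symm
  calc ∫ a, inner ℝ (g a) (Y a) ∂π.prod (Measure.infinitePi ρ)
      = ∫ q, inner ℝ (g (resample p q.1 q.2)) (Y (resample p q.1 q.2))
          ∂(π.prod (Measure.infinitePi ρ)).prod (ρ p) := by
        nth_rewrite 1 [← hres.map_eq]
        refine integral_map hres.aemeasurable ?_
        rw [hres.map_eq]
        exact hgY.aestronglyMeasurable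
    _ = ∫ a, ∫ v, inner ℝ (g (resample p a v)) (Y (resample p a v)) ∂ρ p
          ∂π.prod (Measure.infinitePi ρ) :=
        integral_prod _ (hres.integrable_comp_of_integrable hgY)
    _ = ∫ a, inner ℝ (∫ v, g (resample p a v) ∂ρ p) (Y a) ∂π.prod (Measure.infinitePi ρ) := by
        refine integral_congr_ae ?_
        filter_upwards [hsection] with a ha
        simp only [hY, real_inner_comm (Y a)]
        exact integral_inner ha (Y a)

end Resample

section OrthogonalSums

theorem ae_norm_sum_range_le {α E : Type*} [MeasurableSpace α] {ν : Measure α}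
    [NormedAddCommGroup E] {X : ℕ → α → E} {B : ℝ} {T : ℕ}
    (hB : ∀ n < T, ∀ᵐ a ∂ν, ‖X n a‖ ≤ B) :
    ∀ᵐ a ∂ν, ‖∑ n ∈ Finset.range T, X n a‖ ≤ T * B := by
  have hall : ∀ᵐ a ∂ν, ∀ n ∈ Finset.range T, ‖X n a‖ ≤ B :=
    (Finset.eventually_all _).2 fun n hn => hB n (Finset.mem_range.1 hn)
  filter_upwards [hall] with a ha
  simpa using norm_sum_le_of_le _ ha

theorem integrable_inner_of_memLp_two {α E : Type*} [MeasurableSpace α] {ν : Measure α}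
    [NormedAddCommGroup E] [InnerProductSpace ℝ E] {f g : α → E} (hf : MemLp f 2 ν)
    (hg : MemLp g 2 ν) : Integrable (fun a => inner ℝ (f a) (g a)) ν :=
  (hf.norm.integrable_mul hg.norm).mono' (hf.1.inner hg.1)
    (.of_forall fun _ => abs_real_inner_le_norm _ _)

variable {α : Type*} [MeasurableSpace α] {ν : Measure α} [IsProbabilityMeasure ν]

theorem integral_le_of_integral_sq_le {f : α → ℝ} (hf : MemLp f 2 ν) {b : ℝ} (hb : 0 ≤ b)
    (hsq : ∫ a, f a ^ 2 ∂ν ≤ b ^ 2) : ∫ a, f a ∂ν ≤ b := by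
  have hvar := variance_nonneg f ν
  rw [variance_eq_sub hf] at hvar
  exact le_of_sq_le_sq ((sub_nonneg.1 hvar).trans hsq) hb

variable {E : Type*} [NormedAddCommGroup E] [InnerProductSpace ℝ E] {X : ℕ → α → E} {B : ℝ}

theorem integral_norm_sum_sq_le_of_orthogonal (hX : ∀ n, AEStronglyMeasurable (X n) ν) {T : ℕ}
    (hB : ∀ n < T, ∀ᵐ a ∂ν, ‖X n a‖ ≤ B)
    (horth : ∀ n < T, ∫ a, inner ℝ (∑ k ∈ Finset.range n, X k a) (X n a) ∂ν = 0) :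
    ∫ a, ‖∑ n ∈ Finset.range T, X n a‖ ^ 2 ∂ν ≤ T * B ^ 2 := by
  induction T with
  | zero => simp
  | succ T ih =>
    have hprev := ih (fun n hn => hB n (hn.trans T.lt_succ_self))
      (fun n hn => horth n (hn.trans T.lt_succ_self))
    have hsum : MemLp (fun a => ∑ n ∈ Finset.range T, X n a) 2 ν :=
      .of_bound (Finset.aestronglyMeasurable_fun_sum _ fun n _ => hX n) (T * B)
        (ae_norm_sum_range_le fun n hn => hB n (hn.trans T.lt_succ_self))
    have hlast : MemLp (X T) 2 ν := .of_bound (hX T) B (hB T T.lt_succ_self)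
    have hinner := integrable_inner_of_memLp_two hsum hlast
    have hlast_sq : ∫ a, ‖X T a‖ ^ 2 ∂ν ≤ B ^ 2 := by
      refine (integral_mono_ae (hlast.integrable_norm_pow two_ne_zero)
        (integrable_const (B ^ 2)) ?_).trans_eq (by simp)
      filter_upwards [hB T T.lt_succ_self] with a ha
      exact pow_le_pow_left₀ (norm_nonneg _) ha 2
    simp only [Finset.sum_range_succ, norm_add_sq_real]
    rw [integral_add ((hsum.integrable_norm_pow two_ne_zero).fun_add (hinner.const_mul 2))
      (hlast.integrable_norm_pow two_ne_zero),
      integral_add (hsum.integrable_norm_pow two_ne_zero) (hinner.const_mul 2),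
      integral_const_mul, horth T T.lt_succ_self]
    push_cast
    linarith

theorem integral_norm_sum_le_of_orthogonal (hX : ∀ n, AEStronglyMeasurable (X n) ν) {T : ℕ}
    (hB0 : 0 ≤ B) (hB : ∀ n < T, ∀ᵐ a ∂ν, ‖X n a‖ ≤ B)
    (horth : ∀ n < T, ∫ a, inner ℝ (∑ k ∈ Finset.range n, X k a) (X n a) ∂ν = 0) :
    ∫ a, ‖∑ n ∈ Finset.range T, X n a‖ ∂ν ≤ √T * B := by
  have hsum : MemLp (fun a => ∑ n ∈ Finset.range T, X n a) 2 ν :=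
    .of_bound (Finset.aestronglyMeasurable_fun_sum _ fun n _ => hX n) (T * B)
      (ae_norm_sum_range_le hB)
  refine integral_le_of_integral_sq_le hsum.norm (by positivity) ?_
  rw [mul_pow, Real.sq_sqrt T.cast_nonneg]
  exact integral_norm_sum_sq_le_of_orthogonal hX hB horth

end OrthogonalSums

theorem measurable_iInf_of_continuous {α Y : Type*} [MeasurableSpace α] [TopologicalSpace Y]
    [CompactSpace Y] [TopologicalSpace.SeparableSpace Y] [Nonempty Y] {h : α → Y → ℝ}
    (hm : ∀ y, Measurable fun a => h a y) (hc : ∀ a, Continuous (h a)) :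
    Measurable fun a => ⨅ y, h a y := by
  have hdense : ∀ a, ⨅ y, h a y = ⨅ n, h a (TopologicalSpace.denseSeq Y n) := fun a => by
    rw [← (TopologicalSpace.denseRange_denseSeq Y).ciInf' (hc a), iInf_range']
  simp only [hdense]
  exact Measurable.iInf fun n => hm _

theorem mul_sum_add_one_rpow_sub_one_le {q : ℝ} (hq0 : 0 ≤ q) (hq1 : q ≤ 1) (T : ℕ) :
    q * ∑ n ∈ Finset.range T, ((n : ℝ) + 1) ^ (q - 1) ≤ (T : ℝ) ^ q := by
  induction T with
  | zero => simpa using Real.rpow_nonneg le_rfl q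
  | succ T ih =>
    have hpos : (0 : ℝ) < T + 1 := by positivity
    have hfactor : (T : ℝ) = ((T : ℝ) + 1) * (1 + -1 / ((T : ℝ) + 1)) := by
      field_simp
      ring
    have hbernoulli : (T : ℝ) ^ q ≤ ((T : ℝ) + 1) ^ q - q * ((T : ℝ) + 1) ^ (q - 1) := by
      have hs : -1 ≤ -1 / ((T : ℝ) + 1) := by
        rw [le_div_iff₀ hpos]
        linarith [T.cast_nonneg (α := ℝ)]
      calc (T : ℝ) ^ q = ((T : ℝ) + 1) ^ q * (1 + -1 / ((T : ℝ) + 1)) ^ q := by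
            rw [← Real.mul_rpow hpos.le (by linarith), ← hfactor]
        _ ≤ ((T : ℝ) + 1) ^ q * (1 + q * (-1 / ((T : ℝ) + 1))) := by
            gcongr
            exact rpow_one_add_le_one_add_mul_self hs hq0 hq1
        _ = ((T : ℝ) + 1) ^ q - q * ((T : ℝ) + 1) ^ (q - 1) := by
            rw [Real.rpow_sub_one hpos.ne']
            ring
    rw [Finset.sum_range_succ, mul_add]
    push_cast
    linarith

end EnergySharing

namespace EnergySharing

section Powers

theorem rpow_mul_rpow_sq {x : ℝ} (hx : 0 < x) (a b : ℝ) :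
    x ^ a * (x ^ b) ^ 2 = x ^ (a + 2 * b) := by
  rw [← Real.rpow_natCast, ← Real.rpow_mul hx.le, ← Real.rpow_add hx, Nat.cast_ofNat, mul_comm b]

theorem add_rpow_le_mul_rpow {q x c : ℝ} (hq0 : 0 ≤ q) (hq1 : q ≤ 1) (hx : 1 ≤ x)
    (hc : 0 ≤ c) : (x + c) ^ q ≤ (c + 1) * x ^ q := by
  calc (x + c) ^ q ≤ ((c + 1) * x) ^ q :=
        Real.rpow_le_rpow (by positivity) (by nlinarith) hq0
    _ = (c + 1) ^ q * x ^ q := Real.mul_rpow (by positivity) (by positivity)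
    _ ≤ (c + 1) * x ^ q := by
        gcongr
        exact Real.rpow_le_self_of_one_le (by linarith) hq1

theorem sum_add_one_rpow_neg_quarter_le (T : ℕ) :
    ∑ n ∈ Finset.range T, ((n : ℝ) + 1) ^ (-(1 / 4) : ℝ) ≤ 4 / 3 * (T : ℝ) ^ (3 / 4 : ℝ) := by
  have hbound := mul_sum_add_one_rpow_sub_one_le (q := 3 / 4) (by norm_num) (by norm_num) T
  norm_num at hbound ⊢
  linarith

end Powers

theorem card_pos_of_node {V : Type*} [Fintype V] (i : V) : (0 : ℝ) < Fintype.card V :=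
  Nat.cast_pos.2 (Fintype.card_pos_iff.2 ⟨i⟩)

variable {V : Type*} [Fintype V] [DecidableEq V] {G : SimpleGraph V} [DecidableRel G.Adj]

section Network

theorem mem_closedNbhd_self (i : V) : i ∈ closedNbhd G i := Finset.mem_insert_self _ _

theorem mem_closedNbhd_comm {i j : V} : i ∈ closedNbhd G j ↔ j ∈ closedNbhd G i := by
  simp only [closedNbhd, Finset.mem_insert, SimpleGraph.mem_neighborFinset, G.adj_comm, eq_comm]

instance nonempty_closedNbhd (i : V) : Nonempty (closedNbhd G i) := ⟨⟨i, mem_closedNbhd_self i⟩⟩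

theorem card_closedNbhd_pos (i : V) : (0 : ℝ) < (closedNbhd G i).card :=
  Nat.cast_pos.2 (Finset.card_pos.2 ⟨i, mem_closedNbhd_self i⟩)

theorem amount_of_mem {k : V} (y : Action G k) {j : V} (h : j ∈ closedNbhd G k) :
    amount y j = y ⟨j, h⟩ := dif_pos h

theorem abs_amount_le {k : V} (y : Action G k) (j : V) : |amount y j| ≤ ‖y‖ := by
  unfold amount
  split_ifs with h
  · exact PiLp.norm_apply_le y ⟨j, h⟩
  · simp

theorem amount_smul {k : V} (c : ℝ) (y : Action G k) (j : V) :
    amount (c • y) j = c * amount y j := by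
  unfold amount
  split_ifs <;> simp

theorem norm_adjust_le {i : V} {d : ℝ} (hd : 0 ≤ d) (y : Action G i) : ‖adjust d y‖ ≤ ‖y‖ := by
  unfold adjust
  split_ifs with h
  · rw [norm_smul, Real.norm_of_nonneg (div_nonneg hd (hd.trans h.le))]
    exact mul_le_of_le_one_left (norm_nonneg _) (div_le_one_of_le₀ h.le (hd.trans h.le))
  · exact le_rfl

theorem constr_adjust_nonpos {i : V} {d : ℝ} (hd : 0 ≤ d) (y : Action G i) :
    constr d (adjust d y) ≤ 0 := by
  unfold constr adjust
  split_ifs with h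
  · simp_rw [amount_smul, ← Finset.mul_sum]
    rw [div_mul_cancel₀ _ (hd.trans_lt h).ne', sub_self]
  · linarith

theorem convexOn_neg_mul_min_div {c : ℝ} (hc : 0 ≤ c) (b l : ℝ) :
    ConvexOn ℝ Set.univ fun s : ℝ => -(c * min ((s + b) / l) 1) := by
  have haffine : ConcaveOn ℝ Set.univ fun s : ℝ => (s + b) / l :=
    ⟨convex_univ, fun x _ y _ p q _ _ hpq => by
      rw [← eq_sub_iff_add_eq] at hpq
      simp only [smul_eq_mul, hpq]
      exact le_of_eq (by ring)⟩
  exact ((haffine.inf (concaveOn_const 1 convex_univ)).smul hc).neg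

theorem abs_min_div_sub_min_div_le {L l : ℝ} (hL : 0 < L) (hl : 1 / L ≤ l) (a b : ℝ) :
    |min (a / l) 1 - min (b / l) 1| ≤ L * |a - b| := by
  have hl_inv : |l⁻¹| ≤ L := by
    rw [abs_of_pos (inv_pos.2 ((one_div_pos.2 hL).trans_le hl))]
    exact inv_le_of_inv_le₀ hL (by rwa [← one_div])
  calc |min (a / l) 1 - min (b / l) 1| ≤ max |a / l - b / l| |(1 : ℝ) - 1| :=
        abs_min_sub_min_le_max _ _ _ _
    _ = |l⁻¹| * |a - b| := by
        rw [sub_self, abs_zero, max_eq_left (abs_nonneg _), ← sub_div, div_eq_inv_mul, abs_mul]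
    _ ≤ L * |a - b| := by gcongr

theorem abs_satisfaction_le {L W : ℝ} (hL : 0 < L) {l : V → ℝ} {j : V} (hl : 1 / L ≤ l j)
    {x : ∀ k, Action G k} (hx : ∀ k, ‖x k‖ ≤ W) :
    |satisfaction l x j| ≤ L * (Fintype.card V * W) := by
  have hW : 0 ≤ W := (norm_nonneg _).trans (hx j)
  calc |satisfaction l x j|
      = |min ((∑ k ∈ closedNbhd G j, amount (x k) j) / l j) 1 - min (0 / l j) 1| := by
        rw [satisfaction, zero_div, min_eq_left zero_le_one, sub_zero]
    _ ≤ L * |∑ k ∈ closedNbhd G j, amount (x k) j - 0| := abs_min_div_sub_min_div_le hL hl _ _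
    _ ≤ L * ∑ _k ∈ closedNbhd G j, W := by
        rw [sub_zero]
        gcongr
        exact (Finset.abs_sum_le_sum_abs _ _).trans
          (Finset.sum_le_sum fun k _ => (abs_amount_le _ _).trans (hx k))
    _ ≤ L * (Fintype.card V * W) := by
        rw [Finset.sum_const, nsmul_eq_mul]
        gcongr
        exact Finset.card_le_univ _

theorem abs_loss_le {L W : ℝ} (hL : 0 < L) {l : V → ℝ} (hl : ∀ j, 1 / L ≤ l j)
    {x : ∀ k, Action G k} (hx : ∀ k, ‖x k‖ ≤ W) (i : V) :
    |loss l x i| ≤ 1 + L * (Fintype.card V * W) := by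
  have hcard := card_closedNbhd_pos (G := G) i
  have haverage : |1 / ((closedNbhd G i).card : ℝ) * ∑ j ∈ closedNbhd G i, satisfaction l x j| ≤
      L * (Fintype.card V * W) := by
    rw [abs_mul, abs_of_pos (one_div_pos.2 hcard), one_div_mul_eq_div, div_le_iff₀' hcard]
    refine (Finset.abs_sum_le_sum_abs _ _).trans ?_
    refine (Finset.sum_le_sum fun j _ => abs_satisfaction_le hL (hl j) hx).trans_eq ?_
    rw [Finset.sum_const, nsmul_eq_mul]
  calc |loss l x i| ≤ |(1 : ℝ)| + _ := abs_sub _ _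
    _ ≤ 1 + L * (Fintype.card V * W) := by
        rw [abs_one]
        gcongr

end Network

section Parameters

/-- Static data with compact convex action sets of nonempty interior and positive constants. -/
structure Params.Admissible (P : Params G) : Prop where
  degree_pos : ∀ i, 0 < G.degree i
  convex : ∀ i, Convex ℝ (P.X i)
  closed : ∀ i, IsClosed (P.X i)
  outer : ∀ i, ∃ c, P.X i ⊆ Metric.closedBall c (P.R i)
  inner : ∀ i, ∃ c, Metric.closedBall c (P.r i) ⊆ P.X i
  r_pos : ∀ i, 0 < P.r i
  F_pos : ∀ i, 0 < P.F i
  L_pos : 0 < P.L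

theorem Params.Valid.admissible {P : Params G} (hP : P.Valid) : P.Admissible where
  degree_pos := hP.degree_pos
  convex := hP.convex
  closed := hP.closed
  outer := hP.outer
  inner := hP.inner
  r_pos := hP.r_pos
  F_pos := hP.F_pos
  L_pos := hP.L_pos

namespace Params

variable {P : Params G}

theorem delta_eq (i : V) (t : ℕ) :
    P.delta i t = P.delta i 1 * (t : ℝ) ^ (-(1 / 4) : ℝ) := by
  simp only [delta]
  rw [Real.div_rpow (by positivity) (by positivity) (1 / 4), Real.rpow_neg (by positivity),
    Nat.cast_one, div_one, mul_assoc, ← div_eq_mul_inv]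

theorem xi_eq (i : V) (t : ℕ) : P.xi i t = P.xi i 1 * (t : ℝ) ^ (-(1 / 4) : ℝ) := by
  rw [xi, delta_eq, mul_div_right_comm, ← xi]

theorem eta_eq (i : V) (k t : ℕ) :
    P.eta i k t = P.eta i k 1 * (t : ℝ) ^ (-(3 / 4) : ℝ) := by
  simp only [eta, Nat.cast_one, Real.one_rpow, mul_one]

theorem gamma_nonneg (i : V) (t : ℕ) : 0 ≤ P.gamma i t := by
  unfold gamma
  positivity

namespace Admissible

variable (hP : P.Admissible) (i : V)
include hP

theorem nonempty : (P.X i).Nonempty := by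
  obtain ⟨c, hc⟩ := hP.inner i
  exact ⟨c, hc (Metric.mem_closedBall_self (hP.r_pos i).le)⟩

theorem isCompact : IsCompact (P.X i) := by
  obtain ⟨c, hc⟩ := hP.outer i
  exact (isCompact_closedBall c (P.R i)).of_isClosed_subset (hP.closed i) hc

theorem isComplete_smul (c : ℝ) : IsComplete (c • P.X i) :=
  ((hP.isCompact i).smul c).isComplete

theorem convex_smul (c : ℝ) : Convex ℝ (c • P.X i) := (hP.convex i).smul c

theorem R_pos : 0 < P.R i := by
  obtain ⟨c, hc⟩ := hP.outer i
  obtain ⟨c', hc'⟩ := hP.inner i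
  obtain ⟨v, hv⟩ := exists_norm_eq (Action G i) (hP.r_pos i).le
  have hcenter : ‖c' - c‖ ≤ P.R i :=
    mem_closedBall_iff_norm.1 (hc (hc' (Metric.mem_closedBall_self (hP.r_pos i).le)))
  have hboundary : ‖c' + v - c‖ ≤ P.R i :=
    mem_closedBall_iff_norm.1 (hc (hc' (by simp [hv])))
  have hv_le : ‖v‖ ≤ ‖c' + v - c‖ + ‖c' - c‖ := by
    simpa using norm_sub_le (c' + v - c) (c' - c)
  linarith [hP.r_pos i]

theorem Ltilde_pos : 0 < P.Ltilde i := by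
  have := hP.L_pos
  have := hP.R_pos i
  have := hP.r_pos i
  unfold Ltilde
  positivity

theorem delta_pos {t : ℕ} (ht : 0 < t) : 0 < P.delta i t := by
  have := hP.Ltilde_pos i
  have := hP.R_pos i
  have := hP.F_pos i
  have := hP.degree_pos i
  unfold delta
  positivity

theorem xi_pos {t : ℕ} (ht : 0 < t) : 0 < P.xi i t := div_pos (hP.delta_pos i ht) (hP.r_pos i)

theorem eta_pos (k : ℕ) {t : ℕ} (ht : 0 < t) : 0 < P.eta i k t := by
  have := hP.Ltilde_pos i
  have := hP.R_pos i
  have := hP.F_pos i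
  have := hP.degree_pos i
  unfold eta
  positivity

theorem delta_anti {s t : ℕ} (hs : 0 < s) (hst : s ≤ t) : P.delta i t ≤ P.delta i s := by
  rw [P.delta_eq i t, P.delta_eq i s]
  have := hP.delta_pos i one_pos
  exact mul_le_mul_of_nonneg_left (Real.rpow_le_rpow_of_nonpos (Nat.cast_pos.2 hs)
    (Nat.cast_le.2 hst) (by norm_num)) this.le

theorem xi_anti {s t : ℕ} (hs : 0 < s) (hst : s ≤ t) : P.xi i t ≤ P.xi i s :=
  div_le_div_of_nonneg_right (hP.delta_anti i hs hst) (hP.r_pos i).le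

theorem eta_anti (k : ℕ) {s t : ℕ} (hs : 0 < s) (hst : s ≤ t) : P.eta i k t ≤ P.eta i k s := by
  rw [P.eta_eq i k t, P.eta_eq i k s]
  have := hP.eta_pos i k one_pos
  exact mul_le_mul_of_nonneg_left (Real.rpow_le_rpow_of_nonpos (Nat.cast_pos.2 hs)
    (Nat.cast_le.2 hst) (by norm_num)) this.le

theorem abs_one_sub_xi_le {t : ℕ} (ht : 0 < t) : |1 - P.xi i t| ≤ 1 + P.xi i 1 := by
  have hpos := hP.xi_pos i ht
  have hle := hP.xi_anti i one_pos ht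
  exact abs_le.2 ⟨by linarith, by linarith⟩

end Admissible

end Params

end Parameters

end EnergySharing

namespace EnergySharing

variable {V : Type*} [Fintype V] [DecidableEq V] {G : SimpleGraph V} [DecidableRel G.Adj]

section Reach

namespace Params

variable (P : Params G)

/-- A common bound on the norms of all points that occur in a run: fixed actions, expert points and
query points. -/
noncomputable def reach : ℝ :=
  ∑ i, ((1 + P.xi i 1) * (⨆ y : P.X i, ‖(y : Action G i)‖) + P.delta i 1)

/-- A common bound on all losses that occur in a run. -/
noncomputable def lossBound : ℝ := 1 + P.L * (Fintype.card V * P.reach)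

/-- Scale of the gradient estimates, which in round `t` are of size `gradBound * t ^ (1 / 4)`. -/
noncomputable def gradBound (i : V) : ℝ := Fintype.card V / P.delta i 1 * P.lossBound

variable {P}

namespace Admissible

variable (hP : P.Admissible) {i : V}
include hP

theorem reach_summand_nonneg (i : V) :
    0 ≤ (1 + P.xi i 1) * (⨆ y : P.X i, ‖(y : Action G i)‖) + P.delta i 1 := by
  have := hP.xi_pos i one_pos
  have := hP.delta_pos i one_pos
  have : 0 ≤ ⨆ y : P.X i, ‖(y : Action G i)‖ := Real.iSup_nonneg fun y => norm_nonneg _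
  positivity

theorem reach_nonneg : 0 ≤ P.reach := Finset.sum_nonneg fun i _ => hP.reach_summand_nonneg i

theorem norm_add_delta_le_reach {y : Action G i} (hy : y ∈ P.X i) :
    (1 + P.xi i 1) * ‖y‖ + P.delta i 1 ≤ P.reach := by
  have hbdd : BddAbove (Set.range fun y : P.X i => ‖(y : Action G i)‖) := by
    obtain ⟨b, hb⟩ := (hP.isCompact i).isBounded.exists_norm_le
    exact ⟨b, Set.forall_mem_range.2 fun y => hb y y.2⟩
  have := hP.xi_pos i one_pos
  calc (1 + P.xi i 1) * ‖y‖ + P.delta i 1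
      ≤ (1 + P.xi i 1) * (⨆ y : P.X i, ‖(y : Action G i)‖) + P.delta i 1 := by
        gcongr
        exact le_ciSup hbdd ⟨y, hy⟩
    _ ≤ P.reach :=
        Finset.single_le_sum (fun i _ => hP.reach_summand_nonneg i) (Finset.mem_univ i)

theorem norm_le_reach {y : Action G i} (hy : y ∈ P.X i) : ‖y‖ ≤ P.reach := by
  have hxi := hP.xi_pos i one_pos
  have hdelta := hP.delta_pos i one_pos
  linarith [hP.norm_add_delta_le_reach hy, mul_nonneg hxi.le (norm_nonneg y)]

theorem norm_add_delta_le_reach_of_mem_smul {t : ℕ} (ht : 0 < t) {y : Action G i}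
    (hy : y ∈ (1 - P.xi i t) • P.X i) : ‖y‖ + P.delta i t ≤ P.reach := by
  obtain ⟨x, hx, rfl⟩ := hy
  calc ‖(1 - P.xi i t) • x‖ + P.delta i t ≤ (1 + P.xi i 1) * ‖x‖ + P.delta i 1 := by
        rw [norm_smul, Real.norm_eq_abs]
        gcongr
        exacts [hP.abs_one_sub_xi_le i ht, hP.delta_anti i one_pos ht]
    _ ≤ P.reach := hP.norm_add_delta_le_reach hx

theorem norm_le_reach_of_mem_smul {t : ℕ} (ht : 0 < t) {y : Action G i}
    (hy : y ∈ (1 - P.xi i t) • P.X i) : ‖y‖ ≤ P.reach := by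
  linarith [hP.norm_add_delta_le_reach_of_mem_smul ht hy, hP.delta_pos i ht]

theorem lossBound_nonneg : 0 ≤ P.lossBound := by
  have := hP.L_pos
  have := hP.reach_nonneg
  unfold lossBound
  positivity

theorem gradBound_nonneg (i : V) : 0 ≤ P.gradBound i := by
  have := hP.lossBound_nonneg
  have := hP.delta_pos i one_pos
  unfold gradBound
  positivity

end Admissible

end Params

end Reach

namespace State

variable {K : ℕ} (s : State G K)

section OneRound

variable (P : Params G) (t : ℕ) (l d : V → ℝ) (u : ∀ i, Action G i) (i : V)

/-- The amount that node `j` receives from the nodes other than `i`. -/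
noncomputable def received (j : V) : ℝ :=
  ∑ k ∈ (closedNbhd G j).erase i, amount (s.played P t d u k) j

theorem ownLoss_eq (y : Action G i) :
    s.ownLoss P t l d u i y = 1 + ∑ j : closedNbhd G i,
      -(1 / ((closedNbhd G i).card : ℝ) * min ((y j + s.received P t d u i j) / l j) 1) := by
  unfold ownLoss loss satisfaction
  rw [Finset.sum_neg_distrib, ← Finset.mul_sum, ← sub_eq_add_neg, ← Finset.sum_coe_sort]
  congr 2
  refine Finset.sum_congr rfl fun j _ => ?_
  have hi : i ∈ closedNbhd G j := mem_closedNbhd_comm.2 j.2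
  rw [← Finset.add_sum_erase _ _ hi, Function.update_self, amount_of_mem y j.2, received]
  congr 3
  refine Finset.sum_congr rfl fun k hk => ?_
  rw [Function.update_of_ne (Finset.ne_of_mem_erase hk)]

theorem ownLoss_update_direction (v : Action G i) :
    s.ownLoss P t l d (Function.update u i v) i = s.ownLoss P t l d u i := by
  funext y
  simp only [ownLoss]
  congr 1
  ext1 k
  obtain rfl | hk := eq_or_ne k i
  · simp only [Function.update_self]
  · simp only [played, query, Function.update_of_ne hk]

variable {P l}

theorem lipschitzWith_ownLoss (hL : 0 < P.L) (hl : ∀ j, 1 / P.L ≤ l j) :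
    LipschitzWith P.L.toNNReal (s.ownLoss P t l d u i) := by
  refine LipschitzWith.of_dist_le_mul fun y y' => ?_
  have hcard := card_closedNbhd_pos (G := G) i
  rw [Real.dist_eq, dist_eq_norm, Real.coe_toNNReal _ hL.le, ownLoss_eq, ownLoss_eq,
    add_sub_add_left_eq_sub, ← Finset.sum_sub_distrib]
  have hsummand : ∀ j : closedNbhd G i,
      |-(1 / ((closedNbhd G i).card : ℝ) * min ((y j + s.received P t d u i j) / l j) 1) -
        -(1 / ((closedNbhd G i).card : ℝ) * min ((y' j + s.received P t d u i j) / l j) 1)| ≤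
      1 / ((closedNbhd G i).card : ℝ) * (P.L * ‖y - y'‖) := fun j => by
    rw [neg_sub_neg, ← mul_sub, abs_mul, abs_of_pos (one_div_pos.2 hcard), abs_sub_comm]
    gcongr
    refine (abs_min_div_sub_min_div_le hL (hl j) _ _).trans ?_
    rw [add_sub_add_right_eq_sub]
    gcongr
    exact PiLp.norm_apply_le (y - y') j
  refine (Finset.abs_sum_le_sum_abs _ _).trans
    ((Finset.sum_le_sum fun j _ => hsummand j).trans_eq ?_)
  rw [Finset.sum_const, Finset.card_univ, Fintype.card_coe, nsmul_eq_mul]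
  field_simp

theorem abs_ownLoss_sub_le (hL : 0 < P.L) (hl : ∀ j, 1 / P.L ≤ l j) (y y' : Action G i) :
    |s.ownLoss P t l d u i y - s.ownLoss P t l d u i y'| ≤ P.L * ‖y - y'‖ := by
  have hdist := (s.lipschitzWith_ownLoss t d u i hL hl).dist_le_mul y y'
  rwa [Real.dist_eq, dist_eq_norm, Real.coe_toNNReal _ hL.le] at hdist

theorem abs_ownLoss_le (hL : 0 < P.L) (hl : ∀ j, 1 / P.L ≤ l j) (hd : ∀ j, 0 ≤ d j) {W : ℝ}
    (hW : ∀ k, ‖s.query P t u k‖ ≤ W) {y : Action G i} (hy : ‖y‖ ≤ W) :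
    |s.ownLoss P t l d u i y| ≤ 1 + P.L * (Fintype.card V * W) := by
  refine abs_loss_le hL hl (fun k => ?_) i
  obtain rfl | hk := eq_or_ne k i
  · rwa [Function.update_self]
  · rw [Function.update_of_ne hk]
    exact (norm_adjust_le (hd k) _).trans (hW k)

theorem card_mul_inner_sphericalGradient_ownLoss_le (hL : 0 < P.L) (hl : ∀ j, 1 / P.L ≤ l j)
    {δ : ℝ} (hδ : 0 < δ) (z x : Action G i) :
    (closedNbhd G i).card * inner ℝ (sphericalGradient δ (s.ownLoss P t l d u i) z) (x - z) ≤
      s.ownLoss P t l d u i x - s.ownLoss P t l d u i z + 2 * P.L * δ := by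
  have hcard := card_closedNbhd_pos (G := G) i
  have hinv := one_div_pos.2 hcard
  have hlip : ∀ j : closedNbhd G i, LipschitzWith (1 / ((closedNbhd G i).card : ℝ) * P.L).toNNReal
      fun a => -(1 / ((closedNbhd G i).card : ℝ) *
        min ((a + s.received P t d u i j) / l j) 1) := fun j => by
    refine LipschitzWith.of_dist_le_mul fun a b => ?_
    rw [Real.coe_toNNReal _ (by positivity), Real.dist_eq, Real.dist_eq, neg_sub_neg, ← mul_sub,
      abs_mul, abs_of_pos hinv, abs_sub_comm, mul_assoc]
    gcongr
    simpa only [add_sub_add_right_eq_sub] using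
      abs_min_div_sub_min_div_le hL (hl j) (a + s.received P t d u i j) (b + s.received P t d u i j)
  have hgrad := card_mul_inner_sphericalGradient_le (s.ownLoss_eq P t l d u i)
    (fun j : closedNbhd G i => convexOn_neg_mul_min_div hinv.le (s.received P t d u i j) (l j))
    hlip hδ z x
  rw [Fintype.card_coe, Real.coe_toNNReal _ (by positivity)] at hgrad
  refine hgrad.trans_eq ?_
  field_simp

theorem norm_gradLoss_le {M : ℝ} (hδ : 0 < P.delta i t) (hu : ‖u i‖ = 1)
    (hM : |s.ownLoss P t l d u i (s.query P t u i)| ≤ M) :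
    ‖s.gradLoss P t l d u i‖ ≤ Fintype.card V / P.delta i t * M := by
  rw [gradLoss, norm_smul, hu, mul_one, Real.norm_eq_abs, abs_mul, abs_of_nonneg (by positivity)]
  gcongr

theorem sum_weight_mul_surrogate (hw : ∑ k, s.weight i k = 1) :
    ∑ k, s.weight i k * s.surrogate P t l d u i (s.point i k) = 0 := by
  calc ∑ k, s.weight i k * s.surrogate P t l d u i (s.point i k)
      = inner ℝ (s.gradLoss P t l d u i)
          (∑ k, (s.weight i k • s.point i k - s.weight i k • s.center i)) := by
        simp only [surrogate, inner_sum, ← smul_sub, inner_smul_right]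
    _ = 0 := by
        rw [Finset.sum_sub_distrib, ← Finset.sum_smul, hw, one_smul, center, sub_self,
          inner_zero_right]

theorem nextDual_eq_zero (hs : s.dual i = 0) (hd : 0 ≤ d i) : s.nextDual P t d u i = 0 := by
  rw [nextDual, hs, mul_zero, sub_zero, zero_add]
  exact max_eq_right (mul_nonpos_of_nonneg_of_nonpos (P.gamma_nonneg i _)
    (constr_adjust_nonpos hd _))

end OneRound

end State

section Measurability

variable {α : Type*} [MeasurableSpace α]

theorem measurable_amount {k : V} {y : α → Action G k} (hy : Measurable y) (j : V) :
    Measurable fun a => amount (y a) j := by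
  unfold amount
  split_ifs <;> fun_prop

theorem measurable_constr {i : V} {d : α → ℝ} {y : α → Action G i} (hd : Measurable d)
    (hy : Measurable y) : Measurable fun a => constr (d a) (y a) :=
  (Finset.measurable_fun_sum _ fun j _ => measurable_amount hy j).sub hd

theorem measurable_adjust {i : V} {d : α → ℝ} {y : α → Action G i} (hd : Measurable d)
    (hy : Measurable y) : Measurable fun a => adjust (d a) (y a) := by
  have hsum : Measurable fun a => ∑ j ∈ closedNbhd G i, amount (y a) j :=
    Finset.measurable_fun_sum _ fun j _ => measurable_amount hy j
  exact Measurable.ite (measurableSet_lt hd hsum) ((hd.div hsum).smul hy) hy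

theorem measurable_loss (l : V → ℝ) {x : α → ∀ k, Action G k}
    (hx : ∀ k, Measurable fun a => x a k) (i : V) : Measurable fun a => loss l (x a) i := by
  unfold loss satisfaction
  refine measurable_const.sub (measurable_const.mul (Finset.measurable_fun_sum _ fun j _ => ?_))
  exact ((Finset.measurable_fun_sum _ fun k _ => measurable_amount (hx k) j).div_const _).min
    measurable_const

/-- Componentwise measurability of a random state. -/
structure State.IsMeasurable {K : ℕ} (s : α → State G K) : Prop where
  point : ∀ i k, Measurable fun a => (s a).point i k
  weight : ∀ i k, Measurable fun a => (s a).weight i k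
  dual : ∀ i, Measurable fun a => (s a).dual i

namespace State.IsMeasurable

variable {K : ℕ} {s : α → State G K} {P : Params G} {t : ℕ} {l : V → ℝ}
  {d : V → α → ℝ} {u : ∀ i, α → Action G i}

theorem center (hs : IsMeasurable s) (i : V) : Measurable fun a => (s a).center i :=
  Finset.measurable_fun_sum _ fun k _ => (hs.weight i k).smul (hs.point i k)

theorem query (hs : IsMeasurable s) (hu : ∀ i, Measurable (u i)) (i : V) :
    Measurable fun a => (s a).query P t (fun k => u k a) i :=
  (hs.center i).add ((hu i).const_smul (P.delta i t))

variable (hs : IsMeasurable s) (hd : ∀ i, Measurable (d i)) (hu : ∀ i, Measurable (u i)) (i : V)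
include hs hd hu

theorem played : Measurable fun a => (s a).played P t (fun k => d k a) (fun k => u k a) i :=
  measurable_adjust (hd i) (hs.query hu i)

theorem ownLoss {y : α → Action G i} (hy : Measurable y) :
    Measurable fun a => (s a).ownLoss P t l (fun k => d k a) (fun k => u k a) i (y a) := by
  refine measurable_loss l (fun k => ?_) i
  obtain rfl | hk := eq_or_ne k i
  · simpa only [Function.update_self] using hy
  · simpa only [Function.update_of_ne hk] using hs.played hd hu k

theorem gradLoss :
    Measurable fun a => (s a).gradLoss P t l (fun k => d k a) (fun k => u k a) i :=
  ((hs.ownLoss hd hu i (hs.query hu i)).const_mul _).smul (hu i)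

theorem gradConstr : Measurable fun a => (s a).gradConstr P t (fun k => d k a) (fun k => u k a) i :=
  ((measurable_constr (hd i) (hs.query hu i)).const_mul _).smul (hu i)

theorem nextDual : Measurable fun a => (s a).nextDual P t (fun k => d k a) (fun k => u k a) i :=
  ((hs.dual i).add (((measurable_constr (hd i) (hs.played hd hu i)).sub
    ((hs.dual i).const_mul _)).const_mul _)).max measurable_const

theorem surrogate {y : α → Action G i} (hy : Measurable y) :
    Measurable fun a => (s a).surrogate P t l (fun k => d k a) (fun k => u k a) i (y a) :=
  (hs.gradLoss hd hu i).inner (hy.sub (hs.center i))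

omit i in
theorem next (hP : P.Admissible) (ε : ℝ) :
    IsMeasurable fun a => (s a).next P ε t l (fun k => d k a) (fun k => u k a) where
  point i k := (lipschitzWith_proj ((hP.nonempty i).smul_set) (hP.isComplete_smul i _)
    (hP.convex_smul i _)).continuous.measurable.comp ((hs.point i k).sub
      (Measurable.fun_const_smul (Measurable.fun_add (hs.gradLoss hd hu i)
        (Measurable.fun_smul (hs.nextDual hd hu i) (hs.gradConstr hd hu i))) _))
  weight i k := by
    have hfactor : ∀ k, Measurable fun a => (s a).weight i k * Real.exp (-ε *
        (s a).surrogate P t l (fun k => d k a) (fun k => u k a) i ((s a).point i k)) := fun k =>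
      (hs.weight i k).mul
        (Real.measurable_exp.comp ((hs.surrogate hd hu i (hs.point i k)).const_mul _))
    exact (hfactor k).div (Finset.measurable_fun_sum _ fun k _ => hfactor k)
  dual i := hs.nextDual hd hu i

end State.IsMeasurable

theorem measurable_run {P : Params G} (hP : P.Admissible) (K : ℕ) (ε : ℝ) (l : ℕ → V → ℝ)
    {d : ℕ → V → α → ℝ} {u : ℕ → ∀ i, α → Action G i} {z₀ : ∀ i, α → Action G i}
    (hd : ∀ t i, Measurable (d t i)) (hu : ∀ t i, Measurable (u t i))
    (hz : ∀ i, Measurable (z₀ i)) (n : ℕ) :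
    State.IsMeasurable fun a =>
      run P K ε l (fun t k => d t k a) (fun t k => u t k a) (fun k => z₀ k a) n := by
  induction n with
  | zero => exact ⟨fun i _ => hz i, fun _ _ => measurable_const, fun _ => measurable_const⟩
  | succ n ih => exact ih.next (hd (n + 1)) (hu (n + 1)) hP ε

end Measurability

end EnergySharing

namespace EnergySharing

theorem sum_range_one_div_mul_succ (K : ℕ) :
    ∑ k ∈ Finset.range K, 1 / (((k : ℝ) + 1) * ((k : ℝ) + 2)) = K / ((K : ℝ) + 1) := by
  induction K with
  | zero => simp
  | succ K ih =>
    rw [Finset.sum_range_succ, ih]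
    push_cast
    field_simp
    ring

theorem sum_init_weight (K : ℕ) [NeZero K] :
    ∑ k : Fin K, ((K : ℝ) + 1) / K * (1 / (((k : ℝ) + 1) * ((k : ℝ) + 2))) = 1 := by
  rw [← Finset.mul_sum, Fin.sum_univ_eq_sum_range
    (fun k => 1 / (((k : ℝ) + 1) * ((k : ℝ) + 2))), sum_range_one_div_mul_succ]
  have : (K : ℝ) ≠ 0 := NeZero.ne _
  field_simp

variable {V : Type*} [Fintype V] [DecidableEq V] {G : SimpleGraph V} [DecidableRel G.Adj]

section Model

variable (G) in
/-- Realisations of the generations and of the initial points. -/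
abbrev ExogenousData := (ℕ → V → ℝ) × ∀ i, Action G i

variable (G) in
/-- Realisations of all random inputs. The exploration directions form one family indexed by pairs
of a round and a node, so that they can be resampled one at a time. -/
abbrev Input := ExogenousData G × ∀ p : ℕ × V, Metric.sphere (0 : Action G p.2) 1

/-- Nonnegativity of the generations and feasibility of the initial points. -/
structure ExogenousData.Feasible (b : ExogenousData G) (P : Params G) : Prop where
  generation : ∀ t i, 0 ≤ b.1 t i
  start : ∀ i, b.2 i ∈ (1 - P.xi i 1) • P.X i

/-- The exploration directions of all nodes in round `t`. -/
def Input.direction (a : Input G) (t : ℕ) (i : V) : Action G i := (a.2 (t, i)).1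

theorem norm_direction (a : Input G) (t : ℕ) (i : V) : ‖a.direction t i‖ = 1 :=
  norm_eq_of_mem_sphere _

theorem direction_resample_self (a : Input G) (t : ℕ) (i : V)
    (v : Metric.sphere (0 : Action G i) 1) :
    Input.direction (resample (t, i) a v) t = Function.update (a.direction t) i v := by
  funext k
  obtain rfl | hk := eq_or_ne k i
  · simp [Input.direction, resample]
  · simp [Input.direction, resample, hk]

theorem direction_resample_of_ne (a : Input G) {s t : ℕ} (hst : s ≠ t) (i : V)
    (v : Metric.sphere (0 : Action G i) 1) :
    Input.direction (resample (t, i) a v) s = a.direction s := by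
  funext k
  simp [Input.direction, resample, hst]

variable (P : Params G) (K : ℕ) (ε : ℝ) (l : ℕ → V → ℝ) (n : ℕ) (a : Input G) (i : V)

/-- The state at the beginning of round `n + 1`. -/
noncomputable def stateAt : State G K := run P K ε l a.1.1 a.direction a.1.2 n

/-- The loss function of node `i` in round `n + 1`. -/
noncomputable def lossAt : Action G i → ℝ :=
  (stateAt P K ε l n a).ownLoss P (n + 1) (l (n + 1)) (a.1.1 (n + 1)) (a.direction (n + 1)) i

/-- The perturbed point of node `i` in round `n + 1`. -/
noncomputable def queryAt : Action G i :=
  (stateAt P K ε l n a).query P (n + 1) (a.direction (n + 1)) i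

/-- The estimate of the gradient of the loss of node `i` in round `n + 1`. -/
noncomputable def gradAt : Action G i :=
  (stateAt P K ε l n a).gradLoss P (n + 1) (l (n + 1)) (a.1.1 (n + 1)) (a.direction (n + 1)) i

/-- The conditional mean of the gradient estimate of node `i` in round `n + 1`, given all inputs
except its own direction in that round. -/
noncomputable def meanAt : Action G i :=
  ∫ v, gradAt P K ε l n (resample (n + 1, i) a v) i ∂uniformSphere (Action G i)

/-- The error of the gradient estimate of node `i` in round `n + 1`. -/
noncomputable def noiseAt : Action G i := meanAt P K ε l n a i - gradAt P K ε l n a i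

theorem stateAt_resample {m : ℕ} (hnm : n < m) (v : Metric.sphere (0 : Action G i) 1) :
    stateAt P K ε l n (resample (m, i) a v) = stateAt P K ε l n a := by
  induction n with
  | zero => rfl
  | succ n ih =>
    have hdirection := direction_resample_of_ne a hnm.ne i v
    have hprev := ih (n.lt_succ_self.trans hnm)
    simp only [stateAt, run] at hprev ⊢
    rw [hprev, hdirection]
    rfl

theorem gradAt_resample {m : ℕ} (hnm : n + 1 < m) (v : Metric.sphere (0 : Action G i) 1) :
    gradAt P K ε l n (resample (m, i) a v) i = gradAt P K ε l n a i := by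
  simp only [gradAt]
  rw [stateAt_resample P K ε l n a i (n.lt_succ_self.trans hnm) v,
    direction_resample_of_ne a hnm.ne i v]
  rfl

theorem lossAt_resample_self (v : Metric.sphere (0 : Action G i) 1) :
    lossAt P K ε l n (resample (n + 1, i) a v) i = lossAt P K ε l n a i := by
  simp only [lossAt]
  rw [stateAt_resample P K ε l n a i n.lt_succ_self v, direction_resample_self]
  exact State.ownLoss_update_direction ..

theorem gradAt_resample_self (v : Metric.sphere (0 : Action G i) 1) :
    gradAt P K ε l n (resample (n + 1, i) a v) i =
      (Fintype.card V : ℝ) • (lossAt P K ε l n a i ((stateAt P K ε l n a).center i +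
        P.delta i (n + 1) • (v : Action G i)) / P.delta i (n + 1)) • (v : Action G i) := by
  have hloss := lossAt_resample_self P K ε l n a i v
  simp only [lossAt] at hloss
  simp only [gradAt, State.gradLoss, hloss, State.query]
  rw [stateAt_resample P K ε l n a i n.lt_succ_self v, direction_resample_self,
    Function.update_self, smul_smul, mul_div_left_comm, mul_comm, ← lossAt]

theorem meanAt_eq : meanAt P K ε l n a i = (Fintype.card V : ℝ) •
    sphericalGradient (P.delta i (n + 1)) (lossAt P K ε l n a i)
      ((stateAt P K ε l n a).center i) := by
  simp only [meanAt, gradAt_resample_self]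
  exact integral_smul _ _

theorem meanAt_resample {m : ℕ} (hnm : n + 1 < m) (v : Metric.sphere (0 : Action G i) 1) :
    meanAt P K ε l n (resample (m, i) a v) i = meanAt P K ε l n a i := by
  have hloss : lossAt P K ε l n (resample (m, i) a v) i = lossAt P K ε l n a i := by
    simp only [lossAt]
    rw [stateAt_resample P K ε l n a i (n.lt_succ_self.trans hnm) v,
      direction_resample_of_ne a hnm.ne i v]
    rfl
  rw [meanAt_eq, meanAt_eq, hloss,
    stateAt_resample P K ε l n a i (n.lt_succ_self.trans hnm) v]

theorem noiseAt_resample {m : ℕ} (hnm : n + 1 < m) (v : Metric.sphere (0 : Action G i) 1) :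
    noiseAt P K ε l n (resample (m, i) a v) i = noiseAt P K ε l n a i := by
  rw [noiseAt, noiseAt, meanAt_resample P K ε l n a i hnm, gradAt_resample P K ε l n a i hnm]

end Model

section RunBounds

variable {P : Params G} {K : ℕ} (ε : ℝ) {l : ℕ → V → ℝ} (n : ℕ) {a : Input G} (i : V)

theorem weight_stateAt_succ : (stateAt P K ε l (n + 1) a).weight i =
    exponentialUpdate ε ((stateAt P K ε l n a).weight i) (fun k =>
      inner ℝ (gradAt P K ε l n a i)
        ((stateAt P K ε l n a).point i k - (stateAt P K ε l n a).center i)) :=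
  rfl

theorem weight_stateAt_pos [NeZero K] (k : Fin K) : 0 < (stateAt P K ε l n a).weight i k := by
  induction n generalizing k with
  | zero =>
    have : (0 : ℝ) < K := Nat.cast_pos.2 (NeZero.pos K)
    simp only [stateAt, run, State.init]
    positivity
  | succ n ih =>
    rw [weight_stateAt_succ]
    exact exponentialUpdate_pos ε ih _ k

theorem sum_weight_stateAt [NeZero K] : ∑ k, (stateAt P K ε l n a).weight i k = 1 := by
  cases n with
  | zero => exact sum_init_weight K
  | succ n =>
    rw [weight_stateAt_succ]
    exact sum_exponentialUpdate ε (weight_stateAt_pos ε n i) _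

theorem half_le_weight_stateAt_zero [NeZero K] :
    1 / 2 ≤ (stateAt P K ε l 0 a).weight i (0 : Fin K) := by
  have hK : (0 : ℝ) < K := Nat.cast_pos.2 (NeZero.pos K)
  simp only [stateAt, run, State.init, Fin.val_zero, Nat.cast_zero, zero_add, one_mul]
  refine le_mul_of_one_le_left (by norm_num) ?_
  rw [one_le_div hK]
  linarith

section Feasible

variable (ha : a.1.Feasible P)
include ha

theorem dual_stateAt : (stateAt P K ε l n a).dual i = 0 := by
  induction n with
  | zero => rfl
  | succ n ih => exact State.nextDual_eq_zero _ _ _ _ _ ih (ha.generation _ i)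

theorem point_stateAt_succ (k : Fin K) :
    (stateAt P K ε l (n + 1) a).point i k = proj ((1 - P.xi i (n + 2)) • P.X i)
      ((stateAt P K ε l n a).point i k - P.eta i k (n + 2) • gradAt P K ε l n a i) := by
  have hdual := State.nextDual_eq_zero (P := P) (stateAt P K ε l n a) (n + 1) (a.1.1 (n + 1))
    (a.direction (n + 1)) i (dual_stateAt ε n i ha) (ha.generation (n + 1) i)
  simp only [stateAt, gradAt] at hdual ⊢
  simp only [run, State.next, hdual, zero_smul, add_zero]

variable (hP : P.Admissible)
include hP

theorem point_stateAt_mem (k : Fin K) :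
    (stateAt P K ε l n a).point i k ∈ (1 - P.xi i (n + 1)) • P.X i := by
  cases n with
  | zero => exact ha.start i
  | succ n =>
    rw [point_stateAt_succ ε n i ha]
    exact proj_mem (hP.nonempty i).smul_set (hP.isComplete_smul i _) (hP.convex_smul i _) _

theorem norm_point_stateAt_le (k : Fin K) : ‖(stateAt P K ε l n a).point i k‖ ≤ P.reach :=
  hP.norm_le_reach_of_mem_smul n.succ_pos (point_stateAt_mem ε n i ha hP k)

variable [NeZero K]

theorem center_stateAt_mem : (stateAt P K ε l n a).center i ∈ (1 - P.xi i (n + 1)) • P.X i :=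
  (hP.convex_smul i _).sum_mem (fun k _ => (weight_stateAt_pos ε n i k).le)
    (sum_weight_stateAt ε n i) fun k _ => point_stateAt_mem ε n i ha hP k

theorem norm_center_stateAt_le : ‖(stateAt P K ε l n a).center i‖ ≤ P.reach :=
  hP.norm_le_reach_of_mem_smul n.succ_pos (center_stateAt_mem ε n i ha hP)

theorem norm_queryAt_le : ‖queryAt P K ε l n a i‖ ≤ P.reach := by
  calc ‖queryAt P K ε l n a i‖
      ≤ ‖(stateAt P K ε l n a).center i‖ + P.delta i (n + 1) := by
        refine (norm_add_le _ _).trans_eq ?_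
        rw [norm_smul, norm_direction, mul_one,
          Real.norm_of_nonneg (hP.delta_pos i n.succ_pos).le]
    _ ≤ P.reach :=
        hP.norm_add_delta_le_reach_of_mem_smul n.succ_pos (center_stateAt_mem ε n i ha hP)

variable (hl : ∀ t j, 1 / P.L ≤ l t j)
include hl

theorem abs_lossAt_le {y : Action G i} (hy : ‖y‖ ≤ P.reach) :
    |lossAt P K ε l n a i y| ≤ P.lossBound :=
  State.abs_ownLoss_le _ _ _ _ _ hP.L_pos (hl _) (ha.generation _)
    (fun k => norm_queryAt_le ε n k ha hP) hy

theorem norm_gradAt_le :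
    ‖gradAt P K ε l n a i‖ ≤ P.gradBound i * ((n : ℝ) + 1) ^ (1 / 4 : ℝ) := by
  refine (State.norm_gradLoss_le _ _ _ _ _ (hP.delta_pos i n.succ_pos) (norm_direction a _ i)
    (abs_lossAt_le ε n i ha hP hl (norm_queryAt_le ε n i ha hP))).trans_eq ?_
  rw [P.delta_eq i (n + 1), Real.rpow_neg (by positivity), Params.gradBound]
  push_cast
  field_simp

theorem norm_gradAt_le_of_lt {T : ℕ} (hn : n < T) :
    ‖gradAt P K ε l n a i‖ ≤ P.gradBound i * (T : ℝ) ^ (1 / 4 : ℝ) := by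
  refine (norm_gradAt_le ε n i ha hP hl).trans ?_
  have := hP.gradBound_nonneg i
  gcongr
  exact_mod_cast hn

end Feasible

end RunBounds

end EnergySharing

namespace EnergySharing

section LearningRate

/-- The learning rate of the expert weights for horizon `T`, shifted so that it is also positive
for `T = 0`. -/
noncomputable def learningRate (T : ℕ) : ℝ := ((T : ℝ) + 1) ^ (-(3 / 4) : ℝ)

theorem learningRate_pos (T : ℕ) : 0 < learningRate T := by
  unfold learningRate
  positivity

theorem one_div_learningRate_add_le {T : ℕ} (hT : 1 ≤ T) (b : ℝ) :
    1 / learningRate T + T * (learningRate T * (b * (T : ℝ) ^ (1 / 4 : ℝ)) ^ 2) ≤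
      (2 + b ^ 2) * (T : ℝ) ^ (3 / 4 : ℝ) := by
  have hT_pos : (0 : ℝ) < T := Nat.cast_pos.2 hT
  have hinv : 1 / learningRate T ≤ 2 * (T : ℝ) ^ (3 / 4 : ℝ) := by
    rw [learningRate, Real.rpow_neg (by positivity), one_div, inv_inv]
    refine (add_rpow_le_mul_rpow (by norm_num) (by norm_num) (Nat.one_le_cast.2 hT)
      zero_le_one).trans_eq ?_
    norm_num
  have hrate : learningRate T ≤ (T : ℝ) ^ (-(3 / 4) : ℝ) :=
    Real.rpow_le_rpow_of_nonpos hT_pos (by linarith) (by norm_num)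
  have hpow : (T : ℝ) ^ (1 : ℝ) * ((T : ℝ) ^ (-(1 / 4) : ℝ)) = (T : ℝ) ^ (3 / 4 : ℝ) := by
    rw [← Real.rpow_add hT_pos]
    norm_num
  calc 1 / learningRate T + T * (learningRate T * (b * (T : ℝ) ^ (1 / 4 : ℝ)) ^ 2)
      ≤ 2 * (T : ℝ) ^ (3 / 4 : ℝ) +
          T * ((T : ℝ) ^ (-(3 / 4) : ℝ) * (b * (T : ℝ) ^ (1 / 4 : ℝ)) ^ 2) := by gcongr
    _ = (2 + b ^ 2) * (T : ℝ) ^ (3 / 4 : ℝ) := by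
        have hsquare := rpow_mul_rpow_sq hT_pos (-(3 / 4)) (1 / 4)
        norm_num at hsquare hpow ⊢
        linear_combination (T * b ^ 2) * hsquare + b ^ 2 * hpow

end LearningRate

variable {V : Type*} [Fintype V] [DecidableEq V] {G : SimpleGraph V} [DecidableRel G.Adj]

section Constants

variable (G) in
/-- The proportion of the nodes that lie in the closed neighbourhood of `i`. It is the price of
scaling the gradient estimates by the number of nodes instead of the dimension of the action
space. -/
noncomputable def nbhdRatio (i : V) : ℝ := (closedNbhd G i).card / Fintype.card V

theorem nbhdRatio_nonneg (i : V) : 0 ≤ nbhdRatio G i := by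
  unfold nbhdRatio
  positivity

namespace Params

variable (P : Params G) (i : V)

/-- Constant in the regret bound of the expert with number `k + 1`. -/
noncomputable def descentConst (k : ℕ) : ℝ :=
  3 * ((2 * P.reach) ^ 2 + 2 * (2 * P.reach) * (P.xi i 1 * P.reach)) / (2 * P.eta i k 1) +
    2 / 3 * P.eta i k 1 * P.gradBound i ^ 2

/-- Scale of the bias due to exploration and shrinkage, which in round `t` is of size
`biasConst * t ^ (-1 / 4)`. -/
noncomputable def biasConst : ℝ := 3 * P.L * P.delta i 1 + P.L * (P.xi i 1 * P.reach)

/-- Constant in the pathwise regret bound. -/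
noncomputable def pathwiseConst : ℝ :=
  nbhdRatio G i * (2 + (2 * P.reach * P.gradBound i) ^ 2 + P.descentConst i 0) +
    4 / 3 * P.biasConst i

variable {P}

theorem Admissible.one_div_eta_le (hP : P.Admissible) {T : ℕ} (hT : 1 ≤ T) (k : ℕ) :
    1 / P.eta i k (T + 2) ≤ 3 * (T : ℝ) ^ (3 / 4 : ℝ) / P.eta i k 1 := by
  have heta := hP.eta_pos i k one_pos
  calc 1 / P.eta i k (T + 2) = ((T : ℝ) + 2) ^ (3 / 4 : ℝ) / P.eta i k 1 := by
        rw [P.eta_eq i k (T + 2), Real.rpow_neg (by positivity)]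
        push_cast
        field_simp
    _ ≤ (2 + 1) * (T : ℝ) ^ (3 / 4 : ℝ) / P.eta i k 1 := by
        gcongr
        exact add_rpow_le_mul_rpow (by norm_num) (by norm_num) (Nat.one_le_cast.2 hT) zero_le_two
    _ = 3 * (T : ℝ) ^ (3 / 4 : ℝ) / P.eta i k 1 := by norm_num

theorem bias_eq (t : ℕ) :
    3 * P.L * P.delta i t + P.L * (P.xi i t * P.reach) =
      P.biasConst i * (t : ℝ) ^ (-(1 / 4) : ℝ) := by
  rw [P.delta_eq, P.xi_eq, biasConst]
  ring

namespace Admissible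

variable {i} (hP : P.Admissible)
include hP

theorem biasConst_nonneg : 0 ≤ P.biasConst i := by
  have := hP.L_pos
  have := hP.delta_pos i one_pos
  have := hP.xi_pos i one_pos
  have := hP.reach_nonneg
  unfold biasConst
  positivity

theorem sum_norm_shrink_sub_le {x : Action G i} (hx : x ∈ P.X i) (n : ℕ) :
    ∑ m ∈ Finset.range n, ‖(1 - P.xi i (m + 1)) • x - (1 - P.xi i (m + 2)) • x‖ ≤
      P.xi i 1 * P.reach := by
  have hstep : ∀ m ∈ Finset.range n, ‖(1 - P.xi i (m + 1)) • x - (1 - P.xi i (m + 2)) • x‖ ≤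
      (P.xi i (m + 1) - P.xi i (m + 2)) * P.reach := fun m _ => by
    have hxi := hP.xi_anti i m.succ_pos (m + 1).le_succ
    rw [← sub_smul, sub_sub_sub_cancel_left, norm_smul, Real.norm_eq_abs, abs_sub_comm,
      abs_of_nonneg (sub_nonneg.2 hxi)]
    exact mul_le_mul_of_nonneg_left (hP.norm_le_reach hx) (sub_nonneg.2 hxi)
  refine (Finset.sum_le_sum hstep).trans ?_
  rw [← Finset.sum_mul, Finset.sum_range_sub' (fun m => P.xi i (m + 1))]
  exact mul_le_mul_of_nonneg_right (sub_le_self _ (hP.xi_pos i n.succ_pos).le) hP.reach_nonneg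

end Admissible

end Params

end Constants

section Pathwise

variable {P : Params G} {K : ℕ} (ε : ℝ) {l : ℕ → V → ℝ} (n : ℕ) {a : Input G} (i : V)
  (ha : a.1.Feasible P) (hP : P.Admissible) (hl : ∀ t j, 1 / P.L ≤ l t j)

section Experts

variable [NeZero K]
include ha hP hl

theorem sum_inner_gradAt_center_sub_point_zero_le (hε : 0 < ε) (T : ℕ) :
    ∑ n ∈ Finset.range T, inner ℝ (gradAt P K ε l n a i)
        ((stateAt P K ε l n a).center i - (stateAt P K ε l n a).point i 0) ≤
      1 / ε + T * (ε * (2 * P.reach * P.gradBound i * (T : ℝ) ^ (1 / 4 : ℝ)) ^ 2) := by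
  have hsurrogate : ∀ n < T, ∀ k, |inner ℝ (gradAt P K ε l n a i)
      ((stateAt P K ε l n a).point i k - (stateAt P K ε l n a).center i)| ≤
      2 * P.reach * P.gradBound i * (T : ℝ) ^ (1 / 4 : ℝ) := fun n hn k => by
    have hgrad := norm_gradAt_le_of_lt (K := K) ε n i ha hP hl hn
    have hpoint : ‖(stateAt P K ε l n a).point i k - (stateAt P K ε l n a).center i‖ ≤
        2 * P.reach := by
      refine (norm_sub_le _ _).trans ?_
      linarith [norm_point_stateAt_le (l := l) ε n i ha hP k,
        norm_center_stateAt_le (K := K) (l := l) ε n i ha hP]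
    refine (abs_real_inner_le_norm _ _).trans ?_
    refine (mul_le_mul hgrad hpoint (norm_nonneg _) ((norm_nonneg _).trans hgrad)).trans_eq ?_
    ring
  have hregret := sum_neg_le_of_exponentialUpdate hε (weight_stateAt_pos ε · i)
    (sum_weight_stateAt ε · i) (fun n => weight_stateAt_succ ε n i)
    (fun n => State.sum_weight_mul_surrogate _ _ _ _ i (sum_weight_stateAt ε n i)) T hsurrogate 0
  have hlog : -Real.log ((stateAt P K ε l 0 a).weight i 0) ≤ 1 := by
    have := Real.log_le_log one_half_pos (half_le_weight_stateAt_zero (K := K) (P := P) (l := l)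
      (a := a) ε i)
    rw [one_div, Real.log_inv] at this
    linarith [Real.log_two_lt_d9]
  simp only [← inner_neg_right, neg_sub] at hregret
  exact hregret.trans (by gcongr)

theorem half_eta_mul_norm_gradAt_sq_le (k : ℕ) :
    P.eta i k (n + 2) / 2 * ‖gradAt P K ε l n a i‖ ^ 2 ≤
      P.eta i k 1 * P.gradBound i ^ 2 / 2 * ((n : ℝ) + 1) ^ (-(1 / 4) : ℝ) := by
  have heta : P.eta i k (n + 2) ≤ P.eta i k 1 * ((n : ℝ) + 1) ^ (-(3 / 4) : ℝ) := by
    refine (hP.eta_anti i k n.succ_pos (n + 1).le_succ).trans_eq ?_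
    rw [P.eta_eq]
    push_cast
    rfl
  have := hP.eta_pos i k one_pos
  calc P.eta i k (n + 2) / 2 * ‖gradAt P K ε l n a i‖ ^ 2
      ≤ P.eta i k 1 * ((n : ℝ) + 1) ^ (-(3 / 4) : ℝ) / 2 *
          (P.gradBound i * ((n : ℝ) + 1) ^ (1 / 4 : ℝ)) ^ 2 := by
        gcongr
        exact norm_gradAt_le ε n i ha hP hl
    _ = P.eta i k 1 * P.gradBound i ^ 2 / 2 *
          (((n : ℝ) + 1) ^ (-(3 / 4) : ℝ) * (((n : ℝ) + 1) ^ (1 / 4 : ℝ)) ^ 2) := by ring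
    _ = P.eta i k 1 * P.gradBound i ^ 2 / 2 * ((n : ℝ) + 1) ^ (-(1 / 4) : ℝ) := by
        rw [rpow_mul_rpow_sq (by positivity)]
        norm_num

theorem sum_half_eta_mul_norm_gradAt_sq_le (k T : ℕ) :
    ∑ n ∈ Finset.range T, P.eta i k (n + 2) / 2 * ‖gradAt P K ε l n a i‖ ^ 2 ≤
      P.eta i k 1 * P.gradBound i ^ 2 / 2 * (4 / 3 * (T : ℝ) ^ (3 / 4 : ℝ)) := by
  refine (Finset.sum_le_sum fun n _ => half_eta_mul_norm_gradAt_sq_le ε n i ha hP hl k).trans ?_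
  have := hP.eta_pos i k one_pos
  rw [← Finset.mul_sum]
  gcongr
  exact sum_add_one_rpow_neg_quarter_le T

theorem sum_inner_gradAt_point_sub_shrink_le (k : Fin K) {T : ℕ} (hT : 1 ≤ T) {x : Action G i}
    (hx : x ∈ P.X i) :
    ∑ n ∈ Finset.range T, inner ℝ (gradAt P K ε l n a i)
        ((stateAt P K ε l n a).point i k - (1 - P.xi i (n + 2)) • x) ≤
      P.descentConst i k * (T : ℝ) ^ (3 / 4 : ℝ) := by
  have hdiam : ∀ n m, ‖(stateAt P K ε l n a).point i k - (1 - P.xi i (m + 1)) • x‖ ≤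
      2 * P.reach := fun n m => by
    refine (norm_sub_le _ _).trans ?_
    linarith [norm_point_stateAt_le (l := l) ε n i ha hP k,
      hP.norm_le_reach_of_mem_smul m.succ_pos (Set.smul_mem_smul_set hx)]
  have hregret := sum_inner_sub_comparator_le (fun n => hP.isComplete_smul i (1 - P.xi i (n + 1)))
    (fun n => hP.convex_smul i (1 - P.xi i (n + 1)))
    (fun n => point_stateAt_succ (l := l) ε n i ha k) (fun n => Set.smul_mem_smul_set hx)
    (fun n => hP.eta_pos i k (n + 1).succ_pos)
    (antitone_nat_of_succ_le fun n => hP.eta_anti i k (n + 1).succ_pos (n + 2).le_succ)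
    hdiam (hP.sum_norm_shrink_sub_le hx) T
  have hcoeff_nonneg :
      0 ≤ ((2 * P.reach) ^ 2 + 2 * (2 * P.reach) * (P.xi i 1 * P.reach)) / 2 := by
    have := hP.reach_nonneg
    have := hP.xi_pos i one_pos
    positivity
  calc ∑ n ∈ Finset.range T, inner ℝ (gradAt P K ε l n a i)
        ((stateAt P K ε l n a).point i k - (1 - P.xi i (n + 2)) • x)
      ≤ ((2 * P.reach) ^ 2 + 2 * (2 * P.reach) * (P.xi i 1 * P.reach)) / 2 *
            (1 / P.eta i k (T + 2)) +
          ∑ n ∈ Finset.range T, P.eta i k (n + 2) / 2 * ‖gradAt P K ε l n a i‖ ^ 2 := by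
        rwa [div_mul_div_comm, mul_one]
    _ ≤ ((2 * P.reach) ^ 2 + 2 * (2 * P.reach) * (P.xi i 1 * P.reach)) / 2 *
            (3 * (T : ℝ) ^ (3 / 4 : ℝ) / P.eta i k 1) +
          P.eta i k 1 * P.gradBound i ^ 2 / 2 * (4 / 3 * (T : ℝ) ^ (3 / 4 : ℝ)) :=
        add_le_add
          (mul_le_mul_of_nonneg_left (Params.Admissible.one_div_eta_le i hP hT k) hcoeff_nonneg)
          (sum_half_eta_mul_norm_gradAt_sq_le ε i ha hP hl k T)
    _ = P.descentConst i k * (T : ℝ) ^ (3 / 4 : ℝ) := by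
        rw [Params.descentConst]
        ring

end Experts

section OneRound

include hl in
theorem lossAt_query_sub_center_le (hP : P.Admissible) :
    lossAt P K ε l n a i (queryAt P K ε l n a i) -
      lossAt P K ε l n a i ((stateAt P K ε l n a).center i) ≤ P.L * P.delta i (n + 1) := by
  refine (le_abs_self _).trans
    ((State.abs_ownLoss_sub_le _ _ _ _ i hP.L_pos (hl _) _ _).trans_eq ?_)
  rw [queryAt, State.query, add_sub_cancel_left, norm_smul, norm_direction, mul_one,
    Real.norm_of_nonneg (hP.delta_pos i n.succ_pos).le]

include hP hl

theorem lossAt_shrink_sub_le {x : Action G i} (hx : x ∈ P.X i) :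
    lossAt P K ε l n a i ((1 - P.xi i (n + 2)) • x) - lossAt P K ε l n a i x ≤
      P.L * (P.xi i (n + 1) * P.reach) := by
  have hL := hP.L_pos
  refine (le_abs_self _).trans
    ((State.abs_ownLoss_sub_le _ _ _ _ i hL (hl _) _ _).trans ?_)
  have hshift : (1 - P.xi i (n + 2)) • x - x = -(P.xi i (n + 2) • x) := by
    rw [sub_smul, one_smul, sub_sub_cancel_left]
  rw [hshift, norm_neg, norm_smul, Real.norm_of_nonneg (hP.xi_pos i (n + 1).succ_pos).le]
  have := (hP.xi_pos i n.succ_pos).le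
  gcongr
  exacts [hP.xi_anti i n.succ_pos (n + 1).le_succ, hP.norm_le_reach hx]

theorem lossAt_center_sub_le (c : Action G i) :
    lossAt P K ε l n a i ((stateAt P K ε l n a).center i) - lossAt P K ε l n a i c ≤
      nbhdRatio G i * inner ℝ (meanAt P K ε l n a i) ((stateAt P K ε l n a).center i - c) +
        2 * P.L * P.delta i (n + 1) := by
  have hgrad := (stateAt P K ε l n a).card_mul_inner_sphericalGradient_ownLoss_le (n + 1)
    (a.1.1 (n + 1)) (a.direction (n + 1)) i hP.L_pos (hl (n + 1)) (hP.delta_pos i n.succ_pos)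
    ((stateAt P K ε l n a).center i) c
  have hratio : nbhdRatio G i * Fintype.card V = (closedNbhd G i).card :=
    div_mul_cancel₀ _ (card_pos_of_node i).ne'
  rw [meanAt_eq, real_inner_smul_left, ← mul_assoc, hratio, ← neg_sub c, inner_neg_right]
  simp only [lossAt]
  linarith

theorem lossAt_query_sub_le {x : Action G i} (hx : x ∈ P.X i) :
    lossAt P K ε l n a i (queryAt P K ε l n a i) - lossAt P K ε l n a i x ≤
      nbhdRatio G i * inner ℝ (meanAt P K ε l n a i)
          ((stateAt P K ε l n a).center i - (1 - P.xi i (n + 2)) • x) +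
        P.biasConst i * ((n : ℝ) + 1) ^ (-(1 / 4) : ℝ) := by
  have hquery := lossAt_query_sub_center_le (K := K) (a := a) ε n i hl hP
  have hcenter := lossAt_center_sub_le (K := K) (a := a) ε n i hP hl ((1 - P.xi i (n + 2)) • x)
  have hshrink := lossAt_shrink_sub_le (K := K) (a := a) ε n i hP hl hx
  have hbias := P.bias_eq i (n + 1)
  push_cast at hbias
  linarith

end OneRound

theorem sum_inner_meanAt_center_sub_shrink_eq (p : ℕ → Action G i) (x : Action G i) (T : ℕ) :
    ∑ n ∈ Finset.range T, inner ℝ (meanAt P K ε l n a i)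
        ((stateAt P K ε l n a).center i - (1 - P.xi i (n + 2)) • x) =
      ∑ n ∈ Finset.range T, inner ℝ (gradAt P K ε l n a i)
        ((stateAt P K ε l n a).center i - p n) +
      ∑ n ∈ Finset.range T, inner ℝ (gradAt P K ε l n a i)
        (p n - (1 - P.xi i (n + 2)) • x) +
      ∑ n ∈ Finset.range T, inner ℝ (noiseAt P K ε l n a i) ((stateAt P K ε l n a).center i) -
      inner ℝ (∑ n ∈ Finset.range T, (1 - P.xi i (n + 2)) • noiseAt P K ε l n a i) x := by
  rw [sum_inner, ← Finset.sum_add_distrib, ← Finset.sum_add_distrib, ← Finset.sum_sub_distrib]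
  refine Finset.sum_congr rfl fun n _ => ?_
  simp only [noiseAt, inner_sub_left, inner_sub_right, real_inner_smul_left, real_inner_smul_right]
  ring

/-- Bound on the effect that the noise in the gradient estimates has on the regret of node `i`
against an arbitrary comparator in its action set. -/
noncomputable def fluctuation (P : Params G) (K : ℕ) (ε : ℝ) (l : ℕ → V → ℝ) (T : ℕ)
    (a : Input G) (i : V) : ℝ :=
  ∑ n ∈ Finset.range T, inner ℝ (noiseAt P K ε l n a i) ((stateAt P K ε l n a).center i) +
    P.reach * ‖∑ n ∈ Finset.range T, (1 - P.xi i (n + 2)) • noiseAt P K ε l n a i‖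

include ha hP hl

theorem sum_lossAt_query_sub_le [NeZero K] {T : ℕ} (hT : 1 ≤ T) {x : Action G i}
    (hx : x ∈ P.X i) :
    ∑ n ∈ Finset.range T,
        lossAt P K (learningRate T) l n a i (queryAt P K (learningRate T) l n a i) -
      ∑ n ∈ Finset.range T, lossAt P K (learningRate T) l n a i x ≤
      P.pathwiseConst i * (T : ℝ) ^ (3 / 4 : ℝ) +
        nbhdRatio G i * fluctuation P K (learningRate T) l T a i := by
  set ε := learningRate T
  have hrounds := Finset.sum_le_sum fun n (_ : n ∈ Finset.range T) =>
    lossAt_query_sub_le (K := K) (a := a) ε n i hP hl hx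
  rw [Finset.sum_sub_distrib, Finset.sum_add_distrib, ← Finset.mul_sum, ← Finset.mul_sum,
    sum_inner_meanAt_center_sub_shrink_eq ε i (fun n => (stateAt P K ε l n a).point i 0) x T]
    at hrounds
  have hexperts := (sum_inner_gradAt_center_sub_point_zero_le (K := K) ε i ha hP hl
    (learningRate_pos T) T).trans (one_div_learningRate_add_le hT _)
  have hdescent := sum_inner_gradAt_point_sub_shrink_le (K := K) ε i ha hP hl 0 hT hx
  rw [Fin.val_zero] at hdescent
  set S := ∑ n ∈ Finset.range T, (1 - P.xi i (n + 2)) • noiseAt P K ε l n a i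
  have hnoise : -inner ℝ S x ≤ P.reach * ‖S‖ := by
    refine (neg_le_abs _).trans ((abs_real_inner_le_norm S x).trans ?_)
    rw [mul_comm]
    gcongr
    exact hP.norm_le_reach hx
  have hbias := mul_le_mul_of_nonneg_left (sum_add_one_rpow_neg_quarter_le T)
    (hP.biasConst_nonneg (i := i))
  have hratio := mul_le_mul_of_nonneg_left (add_le_add (add_le_add hexperts hdescent) hnoise)
    (nbhdRatio_nonneg (G := G) i)
  rw [Params.pathwiseConst, fluctuation]
  linarith

end Pathwise

end EnergySharing

namespace EnergySharing

variable {V : Type*} [Fintype V] [DecidableEq V] {G : SimpleGraph V} [DecidableRel G.Adj]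
  {P : Params G} (hP : P.Admissible)

section Measurability

variable (K : ℕ) (ε : ℝ) (l : ℕ → V → ℝ) (n : ℕ)

theorem measurable_direction (t : ℕ) (i : V) : Measurable fun a : Input G => a.direction t i :=
  measurable_subtype_coe.comp ((measurable_pi_apply (t, i)).comp measurable_snd)

theorem measurable_generation (t : ℕ) (i : V) : Measurable fun a : Input G => a.1.1 t i := by
  fun_prop

include hP

theorem isMeasurable_stateAt : State.IsMeasurable (stateAt P K ε l n) :=
  measurable_run hP K ε l measurable_generation measurable_direction (fun _ => by fun_prop) n

theorem measurable_lossAt (i : V) {y : Input G → Action G i} (hy : Measurable y) :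
    Measurable fun a => lossAt P K ε l n a i (y a) :=
  (isMeasurable_stateAt hP K ε l n).ownLoss (measurable_generation (n + 1))
    (measurable_direction (n + 1)) i hy

theorem measurable_queryAt (i : V) : Measurable fun a => queryAt P K ε l n a i :=
  (isMeasurable_stateAt hP K ε l n).query (measurable_direction (n + 1)) i

theorem measurable_gradAt (i : V) : Measurable fun a => gradAt P K ε l n a i :=
  (isMeasurable_stateAt hP K ε l n).gradLoss (measurable_generation (n + 1))
    (measurable_direction (n + 1)) i

theorem measurable_meanAt (i : V) : Measurable fun a => meanAt P K ε l n a i :=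
  (((measurable_gradAt hP K ε l n i).comp
    (measurable_resample (n + 1, i))).stronglyMeasurable.integral_prod_right').measurable

theorem measurable_noiseAt (i : V) : Measurable fun a => noiseAt P K ε l n a i :=
  (measurable_meanAt hP K ε l n i).sub (measurable_gradAt hP K ε l n i)

theorem measurable_cumLoss (T : ℕ) (i : V) :
    Measurable fun a : Input G => cumLoss P ε l a.1.1 a.direction a.1.2 T i :=
  Finset.measurable_fun_sum _ fun n _ =>
    measurable_lossAt hP _ ε l n i (measurable_queryAt hP _ ε l n i)

theorem measurable_bestLoss (hl : ∀ t j, 1 / P.L ≤ l t j) (T : ℕ) (i : V) :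
    Measurable fun a : Input G => bestLoss P ε l a.1.1 a.direction a.1.2 T i := by
  have : CompactSpace (P.X i) := isCompact_iff_compactSpace.1 (hP.isCompact i)
  have : Nonempty (P.X i) := (hP.nonempty i).to_subtype
  refine measurable_iInf_of_continuous (fun y => Finset.measurable_fun_sum _ fun n _ =>
    measurable_lossAt hP _ ε l n i measurable_const) fun a => ?_
  exact continuous_finsetSum _ fun n _ =>
    (State.lipschitzWith_ownLoss _ _ _ _ _ hP.L_pos (hl _)).continuous.comp
      continuous_subtype_val

end Measurability

instance (T : ℕ) : NeZero (numExperts T) := ⟨Nat.succ_ne_zero _⟩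

section Bounds

variable {K : ℕ} [NeZero K] (ε : ℝ) {l : ℕ → V → ℝ} {a : Input G} (ha : a.1.Feasible P)
  (hl : ∀ t j, 1 / P.L ≤ l t j) (i : V)
include ha hP hl

theorem norm_noiseAt_le {n T : ℕ} (hn : n < T) :
    ‖noiseAt P K ε l n a i‖ ≤ 2 * P.gradBound i * (T : ℝ) ^ (1 / 4 : ℝ) := by
  have hgrad := norm_gradAt_le_of_lt (K := K) ε n i ha hP hl hn
  have hmean : ‖meanAt P K ε l n a i‖ ≤ P.gradBound i * (T : ℝ) ^ (1 / 4 : ℝ) := by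
    refine (norm_integral_le_of_norm_le_const (.of_forall fun v =>
      norm_gradAt_le_of_lt (a := resample (n + 1, i) a v) ε n i ha hP hl hn)).trans_eq ?_
    rw [probReal_univ, mul_one]
  exact (norm_sub_le _ _).trans (by linarith)

theorem abs_sum_lossAt_le (T : ℕ) {y : ℕ → Action G i} (hy : ∀ n, ‖y n‖ ≤ P.reach) :
    |∑ n ∈ Finset.range T, lossAt P K ε l n a i (y n)| ≤ T * P.lossBound := by
  have hround : ∀ n ∈ Finset.range T, |lossAt P K ε l n a i (y n)| ≤ P.lossBound := fun n _ =>
    abs_lossAt_le ε n i ha hP hl (hy n)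
  refine (Finset.abs_sum_le_sum_abs _ _).trans ((Finset.sum_le_sum hround).trans_eq ?_)
  simp

theorem abs_cumLoss_le (T : ℕ) :
    |cumLoss P ε l a.1.1 a.direction a.1.2 T i| ≤ T * P.lossBound :=
  abs_sum_lossAt_le hP ε ha hl i T fun n => norm_queryAt_le (K := numExperts T) ε n i ha hP

theorem bddBelow_range_sum_lossAt (T : ℕ) : BddBelow (Set.range fun y : P.X i =>
    ∑ n ∈ Finset.range T, lossAt P K ε l n a i y) := by
  refine ⟨-(T * P.lossBound), ?_⟩
  rintro _ ⟨y, rfl⟩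
  exact (abs_le.1 (abs_sum_lossAt_le hP ε ha hl i T fun _ => hP.norm_le_reach y.2)).1

theorem abs_bestLoss_le (T : ℕ) :
    |bestLoss P ε l a.1.1 a.direction a.1.2 T i| ≤ T * P.lossBound := by
  have : Nonempty (P.X i) := (hP.nonempty i).to_subtype
  have hsum : ∀ y : P.X i,
      |∑ n ∈ Finset.range T, lossAt P (numExperts T) ε l n a i y| ≤ T * P.lossBound :=
    fun y => abs_sum_lossAt_le hP ε ha hl i T fun _ => hP.norm_le_reach y.2
  refine abs_le.2 ⟨le_ciInf fun y => (abs_le.1 (hsum y)).1, ?_⟩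
  obtain ⟨y⟩ := this
  exact (ciInf_le (bddBelow_range_sum_lossAt hP ε ha hl i T) y).trans (abs_le.1 (hsum y)).2

end Bounds

section InputLaw

/-- The joint law of the random inputs: the exogenous data have law `π`, and the exploration
directions are uniform and independent of each other and of the data. -/
noncomputable def inputLaw (π : Measure (ExogenousData G)) : Measure (Input G) :=
  π.prod (Measure.infinitePi fun p => uniformSphere (Action G p.2))

variable {π : Measure (ExogenousData G)} (hπ : ∀ᵐ b ∂π, b.Feasible P)

include hπ in
theorem ae_feasible_inputLaw : ∀ᵐ a ∂inputLaw π, a.1.Feasible P :=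
  Measure.quasiMeasurePreserving_fst.ae hπ

variable [IsProbabilityMeasure π]

instance : IsProbabilityMeasure (inputLaw π) := by
  unfold inputLaw
  infer_instance

variable (ε : ℝ) {l : ℕ → V → ℝ} (hl : ∀ t j, 1 / P.L ≤ l t j)
include hP hπ hl

theorem integrable_cumLoss (T : ℕ) (i : V) :
    Integrable (fun a : Input G => cumLoss P ε l a.1.1 a.direction a.1.2 T i) (inputLaw π) :=
  .of_bound (measurable_cumLoss hP ε l T i).aestronglyMeasurable _
    ((ae_feasible_inputLaw hπ).mono fun _ ha => abs_cumLoss_le hP ε ha hl i T)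

theorem integrable_bestLoss (T : ℕ) (i : V) :
    Integrable (fun a : Input G => bestLoss P ε l a.1.1 a.direction a.1.2 T i) (inputLaw π) :=
  .of_bound (measurable_bestLoss hP ε l hl T i).aestronglyMeasurable _
    ((ae_feasible_inputLaw hπ).mono fun _ ha => abs_bestLoss_le hP ε ha hl i T)

variable (K : ℕ) [NeZero K]

theorem memLp_gradAt (n : ℕ) (i : V) : MemLp (gradAt P K ε l n · i) 2 (inputLaw π) :=
  .of_bound (measurable_gradAt hP K ε l n i).aestronglyMeasurable _
    ((ae_feasible_inputLaw hπ).mono fun _ ha => norm_gradAt_le ε n i ha hP hl)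

theorem memLp_noiseAt (n : ℕ) (i : V) : MemLp (noiseAt P K ε l n · i) 2 (inputLaw π) :=
  .of_bound (measurable_noiseAt hP K ε l n i).aestronglyMeasurable _
    ((ae_feasible_inputLaw hπ).mono fun _ ha => norm_noiseAt_le hP ε ha hl i n.lt_succ_self)

omit hl in
theorem memLp_center_stateAt (n : ℕ) (i : V) :
    MemLp (fun a => (stateAt P K ε l n a).center i) 2 (inputLaw π) :=
  .of_bound ((isMeasurable_stateAt hP K ε l n).center i).aestronglyMeasurable _
    ((ae_feasible_inputLaw hπ).mono fun _ ha => norm_center_stateAt_le ε n i ha hP)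

theorem integral_inner_noiseAt_eq_zero (n : ℕ) {i : V} {Y : Input G → Action G i}
    (hY : MemLp Y 2 (inputLaw π)) (hres : ∀ a v, Y (resample (n + 1, i) a v) = Y a) :
    ∫ a, inner ℝ (noiseAt P K ε l n a i) (Y a) ∂inputLaw π = 0 := by
  have hgrad := memLp_gradAt hP hπ ε hl K n i
  have hgradY := integrable_inner_of_memLp_two hgrad hY
  have hnoiseY := integrable_inner_of_memLp_two (memLp_noiseAt hP hπ ε hl K n i) hY
  have hmean : ∫ a, inner ℝ (meanAt P K ε l n a i) (Y a) ∂inputLaw π =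
      ∫ a, inner ℝ (gradAt P K ε l n a i) (Y a) ∂inputLaw π :=
    integral_inner_integral_resample (n + 1, i) (hgrad.integrable one_le_two) hgradY hres
  have hsplit := integral_add hnoiseY hgradY
  simp only [← inner_add_left, noiseAt, sub_add_cancel] at hsplit
  exact right_eq_add.1 (hmean.symm.trans hsplit)

theorem integral_inner_noiseAt_center_eq_zero (n : ℕ) (i : V) :
    ∫ a, inner ℝ (noiseAt P K ε l n a i) ((stateAt P K ε l n a).center i) ∂inputLaw π = 0 :=
  integral_inner_noiseAt_eq_zero hP hπ ε hl K n (memLp_center_stateAt hP hπ ε K n i)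
    fun a v => by rw [stateAt_resample P K ε l n a i n.lt_succ_self]

/-- Scale of the accumulated noise. -/
noncomputable def Params.noiseConst (P : Params G) (i : V) : ℝ :=
  (1 + P.xi i 1) * (2 * P.gradBound i)

omit hπ [IsProbabilityMeasure π] hP hl [NeZero K] in
theorem Params.Admissible.noiseConst_nonneg (hP : P.Admissible) (i : V) : 0 ≤ P.noiseConst i := by
  have := hP.xi_pos i one_pos
  have := hP.gradBound_nonneg i
  unfold Params.noiseConst
  positivity

theorem memLp_smul_noiseAt (c : ℝ) (n : ℕ) (i : V) :
    MemLp (fun a => c • noiseAt P K ε l n a i) 2 (inputLaw π) :=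
  (memLp_noiseAt hP hπ ε hl K n i).const_smul c

theorem integral_norm_sum_noiseAt_le (T : ℕ) (i : V) :
    ∫ a, ‖∑ n ∈ Finset.range T, (1 - P.xi i (n + 2)) • noiseAt P K ε l n a i‖ ∂inputLaw π ≤
      √T * (P.noiseConst i * (T : ℝ) ^ (1 / 4 : ℝ)) := by
  have hconst := hP.noiseConst_nonneg i
  refine integral_norm_sum_le_of_orthogonal
    (fun n => (memLp_smul_noiseAt hP hπ ε hl K _ n i).1) (by positivity) (fun n hn => ?_)
    fun n _ => ?_
  · filter_upwards [ae_feasible_inputLaw hπ] with a ha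
    rw [norm_smul, Real.norm_eq_abs, Params.noiseConst, mul_assoc]
    exact mul_le_mul (hP.abs_one_sub_xi_le i (n + 1).succ_pos) (norm_noiseAt_le hP ε ha hl i hn)
      (norm_nonneg _) (by have := hP.xi_pos i one_pos; positivity)
  · simp only [inner_smul_right, real_inner_comm (noiseAt P K ε l n _ i)]
    rw [integral_const_mul, integral_inner_noiseAt_eq_zero hP hπ ε hl K n
      (memLp_finsetSum _ fun k _ => memLp_smul_noiseAt hP hπ ε hl K _ k i), mul_zero]
    intro a v
    refine Finset.sum_congr rfl fun k hk => ?_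
    rw [noiseAt_resample P K ε l k a i (by simpa using hk)]

theorem integrable_inner_noiseAt_center (n : ℕ) (i : V) : Integrable
    (fun a => inner ℝ (noiseAt P K ε l n a i) ((stateAt P K ε l n a).center i)) (inputLaw π) :=
  integrable_inner_of_memLp_two (memLp_noiseAt hP hπ ε hl K n i)
    (memLp_center_stateAt hP hπ ε K n i)

theorem integrable_norm_sum_noiseAt (T : ℕ) (i : V) : Integrable
    (fun a => ‖∑ n ∈ Finset.range T, (1 - P.xi i (n + 2)) • noiseAt P K ε l n a i‖)
    (inputLaw π) :=
  ((memLp_finsetSum _ fun n _ => memLp_smul_noiseAt hP hπ ε hl K _ n i).integrable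
    one_le_two).norm

theorem integrable_fluctuation (T : ℕ) (i : V) :
    Integrable (fluctuation P K ε l T · i) (inputLaw π) :=
  (integrable_finsetSum _ fun n _ => integrable_inner_noiseAt_center hP hπ ε hl K n i).fun_add
    ((integrable_norm_sum_noiseAt hP hπ ε hl K T i).const_mul _)

theorem integral_fluctuation_le {T : ℕ} (hT : 1 ≤ T) (i : V) :
    ∫ a, fluctuation P K ε l T a i ∂inputLaw π ≤
      P.reach * P.noiseConst i * (T : ℝ) ^ (3 / 4 : ℝ) := by
  have hpow : √T * (T : ℝ) ^ (1 / 4 : ℝ) = (T : ℝ) ^ (3 / 4 : ℝ) := by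
    rw [Real.sqrt_eq_rpow, ← Real.rpow_add (Nat.cast_pos.2 hT)]
    norm_num
  have hinner := fun n (_ : n ∈ Finset.range T) =>
    integrable_inner_noiseAt_center hP hπ ε hl K n i
  simp only [fluctuation]
  rw [integral_add (integrable_finsetSum _ hinner)
      ((integrable_norm_sum_noiseAt hP hπ ε hl K T i).const_mul _),
    integral_finsetSum _ hinner, Finset.sum_eq_zero fun n _ =>
      integral_inner_noiseAt_center_eq_zero hP hπ ε hl K n i, zero_add, integral_const_mul,
    mul_assoc, ← hpow, mul_left_comm (P.noiseConst i)]
  exact mul_le_mul_of_nonneg_left (integral_norm_sum_noiseAt_le hP hπ ε hl K T i)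
    hP.reach_nonneg

end InputLaw

section ExpectedRegret

variable {π : Measure (ExogenousData G)} (hπ : ∀ᵐ b ∂π, b.Feasible P) [IsProbabilityMeasure π]
  {l : ℕ → V → ℝ} (hl : ∀ t j, 1 / P.L ≤ l t j)

/-- Constant in the bound on the expected regret. -/
noncomputable def Params.regretConst (P : Params G) (i : V) : ℝ :=
  P.pathwiseConst i + nbhdRatio G i * (P.reach * P.noiseConst i)

include hP hl in
theorem cumLoss_sub_bestLoss_le {a : Input G} (ha : a.1.Feasible P) {T : ℕ} (hT : 1 ≤ T) (i : V) :
    cumLoss P (learningRate T) l a.1.1 a.direction a.1.2 T i -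
        bestLoss P (learningRate T) l a.1.1 a.direction a.1.2 T i ≤
      P.pathwiseConst i * (T : ℝ) ^ (3 / 4 : ℝ) +
        nbhdRatio G i * fluctuation P (numExperts T) (learningRate T) l T a i := by
  have : Nonempty (P.X i) := (hP.nonempty i).to_subtype
  rw [sub_le_comm]
  refine le_ciInf fun y => ?_
  rw [sub_le_comm]
  exact sum_lossAt_query_sub_le i ha hP hl hT y.2

include hP hπ hl in
theorem integral_cumLoss_sub_integral_bestLoss_le {T : ℕ} (hT : 1 ≤ T) (i : V) :
    ∫ a, cumLoss P (learningRate T) l a.1.1 a.direction a.1.2 T i ∂inputLaw π -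
        ∫ a, bestLoss P (learningRate T) l a.1.1 a.direction a.1.2 T i ∂inputLaw π ≤
      P.regretConst i * (T : ℝ) ^ (3 / 4 : ℝ) := by
  have hcum := integrable_cumLoss hP hπ (learningRate T) hl T i
  have hbest := integrable_bestLoss hP hπ (learningRate T) hl T i
  have hfluct := integrable_fluctuation hP hπ (learningRate T) hl (numExperts T) T i
  have hconst : Integrable (fun _ => P.pathwiseConst i * (T : ℝ) ^ (3 / 4 : ℝ)) (inputLaw π) :=
    integrable_const _
  rw [← integral_sub hcum hbest]
  refine (integral_mono_ae (hcum.sub hbest) (hconst.add (hfluct.const_mul (nbhdRatio G i)))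
    ((ae_feasible_inputLaw hπ).mono fun _ ha => cumLoss_sub_bestLoss_le hP hl ha hT i)).trans ?_
  rw [integral_add' hconst (hfluct.const_mul _), integral_const, probReal_univ, one_smul,
    integral_const_mul, Params.regretConst, add_mul, mul_assoc (nbhdRatio G i)]
  exact add_le_add_right (mul_le_mul_of_nonneg_left
    (integral_fluctuation_le hP hπ _ hl _ hT i) (nbhdRatio_nonneg i)) _

end ExpectedRegret

section Environment

theorem measurableSet_setOf_feasible (hP : P.Admissible) :
    MeasurableSet {b : ExogenousData G | b.Feasible P} := by
  have hset : {b : ExogenousData G | b.Feasible P} =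
      (⋂ t, ⋂ i, {b | 0 ≤ b.1 t i}) ∩ ⋂ i, {b | b.2 i ∈ (1 - P.xi i 1) • P.X i} := by
    ext b
    simp only [Set.mem_inter_iff, Set.mem_iInter]
    exact ⟨fun hb => ⟨hb.1, hb.2⟩, fun hb => ⟨hb.1, hb.2⟩⟩
  rw [hset]
  refine .inter (.iInter fun t => .iInter fun i => measurableSet_le measurable_const
    (by fun_prop)) (.iInter fun i => ?_)
  exact ((hP.isCompact i).smul _).measurableSet.preimage
    ((measurable_pi_apply i).comp measurable_snd)

variable {Ω : Type*} [MeasurableSpace Ω] {μ : Measure Ω}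

/-- The assumptions on the random inputs, and the lower bound on the demands. -/
structure Environment.Admissible (ℰ : Environment G Ω) (P : Params G) (μ : Measure Ω) :
    Prop where
  measurable_d : ∀ t i, Measurable (ℰ.d t i)
  measurable_u : ∀ t i, Measurable (ℰ.u t i)
  measurable_z₀ : ∀ i, Measurable (ℰ.z₀ i)
  demand : ∀ t i, 1 / P.L ≤ ℰ.l t i
  generation : ∀ t i, ∀ᵐ ω ∂μ, 0 ≤ ℰ.d t i ω
  start : ∀ i, ∀ᵐ ω ∂μ, ℰ.z₀ i ω ∈ (1 - P.xi i 1) • P.X i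
  uniform_u : ∀ t i, μ.map (ℰ.u t i) = uniformSphere (Action G i)
  indep_u : iIndepFun (fun (p : ℕ × V) ω => ℰ.u p.1 p.2 ω) μ
  indep_env : IndepFun (fun ω => ((fun t i => ℰ.d t i ω), (fun i => ℰ.z₀ i ω)))
    (fun ω t i => ℰ.u t i ω) μ

variable {ℰ : Environment G Ω}

theorem Environment.Valid.admissible (h : ℰ.Valid P μ) : ℰ.Admissible P μ := { h with }

namespace Environment

/-- The generations and the initial points at a sample point. -/
def exogenousData (ℰ : Environment G Ω) (ω : Ω) : ExogenousData G :=
  (fun t i => ℰ.d t i ω, fun i => ℰ.z₀ i ω)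

/-- All random inputs at a sample point. -/
def input (ℰ : Environment G Ω) (ω : Ω) : Input G :=
  (ℰ.exogenousData ω, fun p => ℰ.u p.1 p.2 ω)

namespace Admissible

variable (h : ℰ.Admissible P μ)
include h

theorem measurable_exogenousData : Measurable ℰ.exogenousData :=
  (measurable_pi_lambda _ fun t => measurable_pi_lambda _ fun i => h.measurable_d t i).prodMk
    (measurable_pi_lambda _ h.measurable_z₀)

theorem ae_feasible (hP : P.Admissible) :
    ∀ᵐ b ∂μ.map ℰ.exogenousData, b.Feasible P := by
  rw [ae_map_iff h.measurable_exogenousData.aemeasurable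
    (measurableSet_setOf_feasible hP)]
  filter_upwards [ae_all_iff.2 fun t => ae_all_iff.2 (h.generation t), ae_all_iff.2 h.start]
    with ω hd hz using ⟨hd, hz⟩

variable [IsProbabilityMeasure μ]

theorem measurePreserving_input :
    MeasurePreserving ℰ.input μ (inputLaw (μ.map ℰ.exogenousData)) := by
  have hdirections : Measurable fun ω (p : ℕ × V) => ℰ.u p.1 p.2 ω :=
    measurable_pi_lambda _ fun p => h.measurable_u p.1 p.2
  have huncurry : Measurable fun (u : ℕ → ∀ i : V, Metric.sphere (0 : Action G i) 1)
      (p : ℕ × V) => u p.1 p.2 := by fun_prop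
  have hindep : IndepFun ℰ.exogenousData (fun ω (p : ℕ × V) => ℰ.u p.1 p.2 ω) μ :=
    h.indep_env.comp measurable_id huncurry
  refine ⟨h.measurable_exogenousData.prodMk hdirections, ?_⟩
  refine (hindep.map_prod_eq_prod_map_map h.measurable_exogenousData.aemeasurable
    hdirections.aemeasurable).trans ?_
  rw [h.indep_u.map_fun_eq_infinitePi_map₀ hdirections.aemeasurable, inputLaw]
  simp only [h.uniform_u]

theorem integrable_algLoss (hP : P.Admissible) (ε : ℝ) (T : ℕ) (i : V) :
    Integrable (ℰ.algLoss P ε T i) μ :=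
  have := Measure.isProbabilityMeasure_map (μ := μ) h.measurable_exogenousData.aemeasurable
  h.measurePreserving_input.integrable_comp_of_integrable
    (integrable_cumLoss hP (h.ae_feasible hP) ε h.demand T i)

theorem integrable_minLoss (hP : P.Admissible) (ε : ℝ) (T : ℕ) (i : V) :
    Integrable (ℰ.minLoss P ε T i) μ :=
  have := Measure.isProbabilityMeasure_map (μ := μ) h.measurable_exogenousData.aemeasurable
  h.measurePreserving_input.integrable_comp_of_integrable
    (integrable_bestLoss hP (h.ae_feasible hP) ε h.demand T i)

theorem staticRegret_le (hP : P.Admissible) {T : ℕ} (hT : 1 ≤ T) (i : V) :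
    ℰ.staticRegret P (learningRate T) T i μ ≤ P.regretConst i * (T : ℝ) ^ (3 / 4 : ℝ) := by
  have := Measure.isProbabilityMeasure_map (μ := μ) h.measurable_exogenousData.aemeasurable
  have hinput := h.measurePreserving_input
  have hregret := integral_cumLoss_sub_integral_bestLoss_le hP (h.ae_feasible hP) h.demand hT i
  rw [← hinput.map_eq, integral_map hinput.aemeasurable
      (measurable_cumLoss hP _ _ T i).aestronglyMeasurable,
    integral_map hinput.aemeasurable
      (measurable_bestLoss hP _ _ h.demand T i).aestronglyMeasurable] at hregret
  exact hregret

end Admissible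

end Environment

end Environment

end EnergySharing

theorem mainTheorem6_general {V : Type*} [Fintype V] [DecidableEq V] (G : SimpleGraph V)
    [DecidableRel G.Adj] (P : EnergySharing.Params G) (hP : P.Admissible) :
    ∃ C : ℝ, ∀ (Ω : Type*) [MeasurableSpace Ω] (μ : Measure Ω) [IsProbabilityMeasure μ]
      (ℰ : EnergySharing.Environment G Ω), ℰ.Admissible P μ → ∀ T : ℕ, 1 ≤ T → ∀ i : V,
        Integrable (ℰ.algLoss P (EnergySharing.learningRate T) T i) μ ∧
        Integrable (ℰ.minLoss P (EnergySharing.learningRate T) T i) μ ∧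
        ℰ.staticRegret P (EnergySharing.learningRate T) T i μ ≤ C * (T : ℝ) ^ (3 / 4 : ℝ) := by
  obtain ⟨C, hC⟩ := Finite.exists_le P.regretConst
  refine ⟨C, fun Ω _ μ _ ℰ h T hT i => ⟨h.integrable_algLoss hP _ T i,
    h.integrable_minLoss hP _ T i, (h.staticRegret_le hP hT i).trans ?_⟩⟩
  gcongr
  exact hC i

theorem mainTheorem6 {V : Type*} [Fintype V] [DecidableEq V] (G : SimpleGraph V)
    [DecidableRel G.Adj] (P : EnergySharing.Params G) (hP : P.Valid) :
    ∃ (ε : ℕ → ℝ) (C : ℝ) (p : ℕ), (∀ T, 0 < ε T) ∧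
      ∀ (Ω : Type*) [MeasurableSpace Ω] (μ : Measure Ω) [IsProbabilityMeasure μ]
        (ℰ : EnergySharing.Environment G Ω), ℰ.Valid P μ →
        ∀ T : ℕ, 1 ≤ T → ∀ i : V,
          Integrable (ℰ.algLoss P (ε T) T i) μ ∧
          Integrable (ℰ.minLoss P (ε T) T i) μ ∧
          ℰ.staticRegret P (ε T) T i μ ≤
            C * (T : ℝ) ^ (3 / 4 : ℝ) * (1 + Real.log (T : ℝ)) ^ p := by
  obtain ⟨C, hC⟩ := mainTheorem6_general G P hP.admissible
  exact ⟨EnergySharing.learningRate, C, 0, EnergySharing.learningRate_pos,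
    fun Ω _ μ _ ℰ h => by simpa only [pow_zero, mul_one] using hC Ω μ ℰ h.admissible⟩
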